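/- **Theorem (P-concept learnability via the Alphatron).** *Setting.* Let $\mathbb B^n\subseteq\mathbb R^n$ be the closed Euclidean unit ball and let $\psi_d:\mathbb B^n\to\mathbb R^{n_d}$, $n_d=\sum_{i=0}^d n^i$, be the feature map with coordinates $[\psi_d(x)]_{(k_1,\dots,k_i)}=\frac1{\sqrt{d+1}}\prod_{j=1}^i x_{k_j}$ for $0\le i\le d$ and $(k_1,\dots,k_i)\in[n]^i$. Let $\mathcal K_d(x,y)=\langle\psi_d(x),\psi_d(y)\rangle$. For $B,L,\zeta,\epsilon>0$ and a (known) non-decreasing $L$-Lipschitz function $u:\mathbb R\to[0,1]$, the concept class consists of all pairs of a probability distribution $\mathcal D$ on $\mathbb B^n\times[0,1]$ and a concept $c$ with $$\mathbb E[y\mid x]=c(x)=u(\langle v,\psi_d(x)\rangle+\xi(x))$$ for some $v\in\mathbb R^{n_d}$ with $\|v\|_2\le B$ and some measurable $\xi:\mathbb B^n\to[-\zeta,\zeta]$ with $\mathbb E_{\mathcal D}[\xi(x)^2]\le\epsilon$. *Algorithm.* Given $(x_i,y_i)_{i=1}^{m_1}$ and $(a_j,b_j)_{j=1}^{m_2}$,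 sampled i.i.d. from $\mathcal D$, the Alphatron starts with $\alpha^0=0\in\mathbb R^{m_1}$, puts $h^t(x)=u\big(\sum_{i=1}^{m_1}\alpha^t_i\mathcal K_d(x,x_i)\big)$ and $\alpha_i^{t+1}=\alpha_i^t+\frac{1}{L m_1}(y_i-h^t(x_i))$, and outputs the hypothesis $h^{t_{\rm out}}$, where $t_{\rm out}$ is the first minimizer over $0\le t<T$ of $\frac1{m_2}\sum_{j=1}^{m_2}(h^t(a_j)-b_j)^2$. Its parameters at confidence $\delta$ are $$T=\Big\lceil CBL\sqrt{m_1/\log(1/\delta)}\,\Big\rceil,\qquad m_2=\lceil C' m_1\log(T/\delta)\rceil .$$ *Claim.* Let $0<\delta_0<1$. For every sufficiently large constant $C$, every sufficiently large constant $C'$ (depending on $\delta_0,C$) and a suitable constant $C''>0$ (depending on $\delta_0,C,C'$), the following holds for all $n,d\in\mathbb N$, all $B,L,\zeta,\epsilon>0$ and all $u$ as above. If the size $m_1=m_1(\delta)$ of the training set satisfies $m_1\ge\max\{m_1',m_1''\}$ for all $\delta\in(0,\delta_0]$, where $$m_1'=\frac{16\zeta^4}{\epsilon^2}\log(1/\delta),\qquad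 m_1''=\frac{4B^2}{\epsilon}\log(1/\delta),$$ then the concept class is weakly p-concept learnable up to $2C''L\sqrt\epsilon$ by the Alphatron, run at confidence $\min\{\delta,\delta_0\}$. That is, for every $\delta>0$ and every $(\mathcal D,c)$ in the class, with probability at least $1-\delta$ over the samples, the output $h$ satisfies $$\mathbb E_{(x,y)\sim\mathcal D}\big[(h(x)-c(x))^2\big]\le 2C''L\sqrt\epsilon .$$ -/

import Mathlib

open MeasureTheory

noncomputable section

/-! ### The learning model -/

/-- `c` is the conditional mean `x ↦ 𝔼[y | x]` of the distribution `D` of labelled examples. -/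
def IsConditionalMean {X : Type*} [MeasurableSpace X] (D : Measure (X × unitInterval))
    (c : X → unitInterval) : Prop :=
  Measurable c ∧
    D[fun p : X × unitInterval => (p.2 : ℝ) |
        MeasurableSpace.comap (Prod.fst : X × unitInterval → X) inferInstance]
      =ᵐ[D] fun p => (c p.1 : ℝ)

/-- The generalization error `𝔼 (h x - c x)²` of the hypothesis `h` for the concept `c`. -/
def generalizationError {X : Type*} [MeasurableSpace X] (D : Measure (X × unitInterval))
    (c h : X → unitInterval) : ℝ :=
  ∫ p, ((h p.1 : ℝ) - (c p.1 : ℝ)) ^ 2 ∂D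

/-- A learning algorithm: given the confidence parameter `δ`, it draws `sampleSize δ` examples
and returns a hypothesis. -/
structure PConceptLearner (X : Type*) where
  sampleSize : ℝ → ℕ
  hypothesis : (δ : ℝ) → (Fin (sampleSize δ) → X × unitInterval) → X → unitInterval

/-- The learner that is run with confidence parameter `δ₀` when a coarser one is asked for. -/
def PConceptLearner.capped {X : Type*} (A : PConceptLearner X) (δ₀ : ℝ) : PConceptLearner X where
  sampleSize δ := A.sampleSize (min δ δ₀)
  hypothesis δ := A.hypothesis (min δ δ₀)

/-- The class `𝒞`, given as a set of pairs (distribution, concept), is weakly p-concept learnable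
up to `ε₀` by the algorithm `A`: for every `δ > 0`, on i.i.d. samples, the output is a (measurable)
hypothesis with generalization error at most `ε₀`, except with probability at most `δ`. -/
def WeakPConceptLearnableBy {X : Type*} [MeasurableSpace X] (A : PConceptLearner X)
    (𝒞 : Set (Measure (X × unitInterval) × (X → unitInterval))) (ε₀ : ℝ) : Prop :=
  ∀ δ : ℝ, 0 < δ → ∀ (D : Measure (X × unitInterval)) [IsProbabilityMeasure D]
    (c : X → unitInterval), (D, c) ∈ 𝒞 → IsConditionalMean D c →
      (Measure.pi fun _ : Fin (A.sampleSize δ) => D)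
          {S | ¬ (Measurable (A.hypothesis δ S) ∧
            generalizationError D c (A.hypothesis δ S) ≤ ε₀)}
        ≤ ENNReal.ofReal δ

/-! ### The multinomial kernel and the concept class -/

/-- The closed unit ball of `ℝⁿ` with the Euclidean norm. -/
abbrev UnitBall (n : ℕ) : Type := Metric.closedBall (0 : EuclideanSpace ℝ (Fin n)) 1

/-- Coordinates are indexed by the tuples `(k₁, …, kᵢ) ∈ [n]ⁱ` with `0 ≤ i ≤ d`. -/
abbrev FeatureSpace (n d : ℕ) : Type :=
  EuclideanSpace ℝ (Σ i : Fin (d + 1), (Fin (i : ℕ) → Fin n))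

/-- The normalized feature map `ψ_d`. -/
def featureMap (n d : ℕ) (x : UnitBall n) : FeatureSpace n d :=
  WithLp.toLp 2 fun k => 1 / √((d : ℝ) + 1) * ∏ j, x.1 (k.2 j)

/-- The normalized multinomial kernel `𝒦_d`. -/
def multinomialKernel (n d : ℕ) (x y : UnitBall n) : ℝ :=
  inner ℝ (featureMap n d x) (featureMap n d y)

/-- The pairs (distribution `D`, concept `c`) with `c x = u (⟨v, ψ_d x⟩ + ξ x)`, where `‖v‖ ≤ B`,
`ξ` takes values in `[-ζ, ζ]` and `𝔼 ξ² ≤ ε`. -/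
def alphatronClass (n d : ℕ) (B ζ ε : ℝ) (u : ℝ → unitInterval) :
    Set (Measure (UnitBall n × unitInterval) × (UnitBall n → unitInterval)) :=
  {p | ∃ (v : FeatureSpace n d) (ξ : UnitBall n → ℝ),
    ‖v‖ ≤ B ∧ Measurable ξ ∧ (∀ x, ξ x ∈ Set.Icc (-ζ) ζ) ∧
    ∫ q, ξ q.1 ^ 2 ∂p.1 ≤ ε ∧
    p.2 = fun x => u (inner ℝ v (featureMap n d x) + ξ x)}

/-! ### The Alphatron -/

/-- The hypothesis `x ↦ u (∑ᵢ αᵢ 𝒦_d(x, xᵢ))`. -/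
def alphatronHypothesis {n m₁ : ℕ} (d : ℕ) (u : ℝ → unitInterval)
    (S : Fin m₁ → UnitBall n × unitInterval) (α : Fin m₁ → ℝ) : UnitBall n → unitInterval :=
  fun x => u (∑ i, α i * multinomialKernel n d x (S i).1)

/-- The vectors `αᵗ`, on the training data `S` and with learning rate `lam`. -/
def alphatronWeights {n m₁ : ℕ} (d : ℕ) (u : ℝ → unitInterval) (lam : ℝ)
    (S : Fin m₁ → UnitBall n × unitInterval) : ℕ → Fin m₁ → ℝ
  | 0 => 0
  | t + 1 => fun i => alphatronWeights d u lam S t i +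
      lam / m₁ * (((S i).2 : ℝ) -
        (alphatronHypothesis d u S (alphatronWeights d u lam S t) (S i).1 : ℝ))

/-- The mean squared error of `h` on the validation data `V`. -/
def validationError {n m₂ : ℕ} (V : Fin m₂ → UnitBall n × unitInterval)
    (h : UnitBall n → unitInterval) : ℝ :=
  1 / m₂ * ∑ j, ((h (V j).1 : ℝ) - ((V j).2 : ℝ)) ^ 2

/-- The (first) index `t < T` for which `hᵗ` has minimal validation error. -/
def alphatronOutputIndex {n m₁ m₂ : ℕ} (d : ℕ) (u : ℝ → unitInterval) (lam : ℝ) (T : ℕ)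
    (S : Fin m₁ → UnitBall n × unitInterval) (V : Fin m₂ → UnitBall n × unitInterval) : ℕ :=
  sInf {t | t < T ∧ ∀ s < T,
    validationError V (alphatronHypothesis d u S (alphatronWeights d u lam S t)) ≤
      validationError V (alphatronHypothesis d u S (alphatronWeights d u lam S s))}

/-- The hypothesis that the Alphatron outputs. -/
def alphatron {n m₁ m₂ : ℕ} (d : ℕ) (u : ℝ → unitInterval) (lam : ℝ) (T : ℕ)
    (S : Fin m₁ → UnitBall n × unitInterval) (V : Fin m₂ → UnitBall n × unitInterval) :
    UnitBall n → unitInterval :=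
  alphatronHypothesis d u S
    (alphatronWeights d u lam S (alphatronOutputIndex d u lam T S V))

/-- The number of iterations `T = C B L √(m₁ / log (1/δ))`, rounded up. -/
def alphatronIterations (C B L δ : ℝ) (m₁ : ℕ) : ℕ :=
  ⌈C * B * L * √((m₁ : ℝ) / Real.log (1 / δ))⌉₊

/-- The size `m₂ = C' m₁ log (T/δ)` of the validation set, rounded up. -/
def alphatronValidationSize (C' δ : ℝ) (m₁ T : ℕ) : ℕ :=
  ⌈C' * m₁ * Real.log (T / δ)⌉₊

/-- The Alphatron as a learning algorithm: with learning rate `1 / L`, a training set of size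
`m₁ δ`, and the iteration count and validation set size above. The sample is split into its first
`m₁ δ` examples, for training, and the others, for validation. -/
def alphatronLearner (n d : ℕ) (u : ℝ → unitInterval) (B L C C' : ℝ) (m₁ : ℝ → ℕ) :
    PConceptLearner (UnitBall n) where
  sampleSize δ := m₁ δ +
    alphatronValidationSize C' δ (m₁ δ) (alphatronIterations C B L δ (m₁ δ))
  hypothesis δ S := alphatron d u (1 / L) (alphatronIterations C B L δ (m₁ δ))
    (fun i => S (Fin.castAdd _ i)) (fun j => S (Fin.natAdd _ j))

end

/-! By the kernel trick, `hᵗ` is the predictor `x ↦ u ⟨wₜ, ψ x⟩` for an explicit vector `wₜ` of the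
feature space, and `‖ψ x‖ ≤ 1`. With `ℓ = log (1/δ)` and `q = √(ℓ/m₁)`, the two lower bounds on `m₁`
say that `4ζ²q ≤ ε` and `Bq ≤ √ε/2`.

Optimization (`norm_sub_sq_step_le`): as `u` is monotone and Lipschitz, each step lowers `‖wₜ - v‖²`
by `e/(2L²)`, where `e` is the empirical risk of `wₜ`, up to errors from the mean noise vector, of
norm `O(q)`, and from the empirical second moment of `ξ`, which is `O(ε)`. The potential starts at
most at `B²`, so among `T ≈ CBL/q` iterates one has `e = O(L²ε + BLq + q²)` and stays within `B` of
`v`.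

Generalization (`pacBayes`): comparing a Gaussian prior with its translates gives bounds uniform
over all weight vectors and free of the dimension. It yields both the noise bound and, with prior
centre `v` and variance `Bq/L`, the passage from empirical risk to risk.

Selection (`measure_validation_selection_le`): the second moment of the excess squared loss is
controlled by the errors themselves, so choosing by validation costs a factor 3 and only `O(1/m₁)`.

All terms become `O(L√ε)`: `BLq ≤ L√ε/2`; one may assume `L√ε ≤ 1`, as errors never exceed 1; and
`q² ≤ CBLq` if `q ≤ CBL`. Otherwise `T = 1`, and the constant output `u 0` is already good enough.
-/

/-! ### Gaussian measure: translation and moments. -/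

section GaussianPrior

variable {E : Type*} [NormedAddCommGroup E] [InnerProductSpace ℝ E] [FiniteDimensional ℝ E]
  [MeasurableSpace E] [BorelSpace E]

variable (E) in
/-- The standard Gaussian measure, by its density. -/
noncomputable def gaussianPrior : Measure E :=
  (volume : Measure E).tilted fun g => -(1 / 2) * ‖g‖ ^ 2

/-- Were it not integrable, its integral would be 0 by convention, against the positive value of the
Gaussian integral. -/
lemma integrable_exp_neg_half_norm_sq :
    Integrable (fun g : E => Real.exp (-(1 / 2) * ‖g‖ ^ 2)) volume := by
  by_contra h
  have h1 := GaussianFourier.integral_rexp_neg_mul_sq_norm (V := E) (b := 1 / 2) (by norm_num)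
  rw [integral_undef h] at h1
  have : 0 < (Real.pi / (1 / 2)) ^ (Module.finrank ℝ E / 2 : ℝ) := by positivity
  linarith

instance : IsProbabilityMeasure (gaussianPrior E) :=
  isProbabilityMeasure_tilted integrable_exp_neg_half_norm_sq

/-- Cameron–Martin formula: the exponential factor is the ratio of the Gaussian densities at `g + a`
and `g`. -/
lemma lintegral_gaussianPrior_shift {F : E → ENNReal} (a : E) :
    ∫⁻ g, F g ∂gaussianPrior E =
      ∫⁻ g, ENNReal.ofReal (Real.exp (-inner ℝ g a - ‖a‖ ^ 2 / 2)) * F (g + a)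
        ∂gaussianPrior E := by
  rw [gaussianPrior, lintegral_tilted, lintegral_tilted,
    ← lintegral_add_right_eq_self _ a]
  refine lintegral_congr fun g => ?_
  rw [← mul_assoc, ← ENNReal.ofReal_mul (by positivity), div_mul_eq_mul_div, ← Real.exp_add]
  congr 4
  rw [norm_add_sq_real]
  ring

lemma integral_inner_gaussianPrior (a : E) : ∫ g, inner ℝ g a ∂gaussianPrior E = 0 := by
  rw [gaussianPrior, integral_tilted]
  set f : E → ℝ := fun g => (Real.exp (-(1 / 2) * ‖g‖ ^ 2) /
    ∫ x : E, Real.exp (-(1 / 2) * ‖x‖ ^ 2)) • inner ℝ g a with hf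
  have h := integral_neg_eq_self f (volume : Measure E)
  have h' : ∀ g, f (-g) = - f g := fun g => by simp [hf]
  simp only [h', integral_neg] at h
  linarith

lemma lintegral_exp_neg_inner_gaussianPrior (a : E) :
    ∫⁻ g, ENNReal.ofReal (Real.exp (-inner ℝ g a)) ∂gaussianPrior E =
      ENNReal.ofReal (Real.exp (‖a‖ ^ 2 / 2)) := by
  have h := lintegral_gaussianPrior_shift (E := E) (F := fun _ => 1) a
  simp only [lintegral_const, measure_univ, mul_one] at h
  have h2 : ∀ g : E, ENNReal.ofReal (Real.exp (-inner ℝ g a)) =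
      ENNReal.ofReal (Real.exp (‖a‖ ^ 2 / 2)) *
        ENNReal.ofReal (Real.exp (-inner ℝ g a - ‖a‖ ^ 2 / 2)) := fun g => by
    rw [← ENNReal.ofReal_mul (by positivity), ← Real.exp_add]
    congr 2; ring
  simp only [h2]
  rw [lintegral_const_mul _ (by fun_prop), ← h, mul_one]

lemma integrable_exp_neg_inner_gaussianPrior (a : E) :
    Integrable (fun g => Real.exp (-inner ℝ g a)) (gaussianPrior E) := by
  refine ⟨by fun_prop, ?_⟩
  rw [hasFiniteIntegral_iff_ofReal (.of_forall fun _ => (Real.exp_pos _).le),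
    lintegral_exp_neg_inner_gaussianPrior]
  exact ENNReal.ofReal_lt_top

lemma integral_exp_neg_inner_gaussianPrior (a : E) :
    ∫ g, Real.exp (-inner ℝ g a) ∂gaussianPrior E = Real.exp (‖a‖ ^ 2 / 2) := by
  rw [integral_eq_lintegral_of_nonneg_ae (.of_forall fun _ => (Real.exp_pos _).le) (by fun_prop),
    lintegral_exp_neg_inner_gaussianPrior, ENNReal.toReal_ofReal (Real.exp_pos _).le]

/-- The right side is `4 sinh² (s/2)`. This derives second moments from the Laplace transform, at
the price of a constant. -/
lemma sq_le_exp_add_exp_neg (s : ℝ) : s ^ 2 ≤ Real.exp (-s) + Real.exp (- -s) - 2 := by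
  have h : (s / 2) ^ 2 ≤ Real.sinh (s / 2) ^ 2 := by
    rw [← sq_abs (Real.sinh _), Real.abs_sinh, ← sq_abs (s / 2)]
    have := Real.self_le_sinh_iff.2 (abs_nonneg (s / 2))
    gcongr
  have h1 := Real.cosh_two_mul (s / 2)
  have h2 := Real.cosh_sq (s / 2)
  have h3 := Real.cosh_eq s
  rw [show 2 * (s / 2) = s by ring] at h1
  rw [neg_neg]
  linarith

lemma integrable_inner_sq_gaussianPrior (a : E) :
    Integrable (fun g => (inner ℝ g a : ℝ) ^ 2) (gaussianPrior E) := by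
  have h1 := integrable_exp_neg_inner_gaussianPrior a
  have h2 := integrable_exp_neg_inner_gaussianPrior (-a)
  simp only [inner_neg_right] at h2
  refine ((h1.add h2).sub (integrable_const (2 : ℝ))).mono' (by fun_prop) (.of_forall fun g => ?_)
  rw [Real.norm_of_nonneg (by positivity)]
  exact sq_le_exp_add_exp_neg _

lemma integrable_inner_gaussianPrior (a : E) :
    Integrable (fun g => (inner ℝ g a : ℝ)) (gaussianPrior E) := by
  refine ((integrable_inner_sq_gaussianPrior a).add (integrable_const (1 : ℝ))).mono'
    (by fun_prop) (.of_forall fun g => ?_)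
  simp only [Pi.add_apply, Real.norm_eq_abs]
  nlinarith [sq_abs (inner ℝ g a : ℝ), sq_nonneg (|inner ℝ g a| - 1), abs_nonneg (inner ℝ g a : ℝ)]

lemma integral_inner_sq_gaussianPrior_le {a : E} (ha : ‖a‖ ≤ 1) :
    ∫ g, (inner ℝ g a : ℝ) ^ 2 ∂gaussianPrior E ≤ 2 := by
  have h1 := integrable_exp_neg_inner_gaussianPrior a
  have h2 := integrable_exp_neg_inner_gaussianPrior (-a)
  have e1 := integral_exp_neg_inner_gaussianPrior a
  have e2 := integral_exp_neg_inner_gaussianPrior (-a)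
  simp only [inner_neg_right, norm_neg] at h2 e2
  have h : ∫ g, (inner ℝ g a : ℝ) ^ 2 ∂gaussianPrior E ≤
      ∫ g, (Real.exp (-inner ℝ g a) + Real.exp (- -inner ℝ g a) - 2) ∂gaussianPrior E :=
    integral_mono (integrable_inner_sq_gaussianPrior a) ((h1.add h2).sub (integrable_const _))
      fun g => sq_le_exp_add_exp_neg _
  rw [integral_sub (by exact h1.add h2) (integrable_const _), integral_add h1 h2, e1, e2] at h
  simp only [integral_const, probReal_univ, smul_eq_mul, one_mul] at h
  have h3 : Real.exp (‖a‖ ^ 2 / 2) ≤ 2 := by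
    calc Real.exp (‖a‖ ^ 2 / 2) ≤ Real.exp (1 / 2) := by
          apply Real.exp_le_exp.2
          nlinarith [norm_nonneg a]
      _ ≤ 2 := by
          have : Real.exp (1 / 2) ^ 2 ≤ 2 ^ 2 := by
            rw [← Real.exp_nat_mul]
            norm_num
            linarith [Real.exp_one_lt_d9]
          exact le_of_sq_le_sq this (by norm_num)
  linarith

end GaussianPrior

/-! ### Change of measure and PAC-Bayes. -/

section ChangeOfMeasure

/-- Jensen's inequality for the exponential function. -/
lemma ofReal_exp_integral_le_lintegral {Ω : Type*} [MeasurableSpace Ω] {μ : Measure Ω}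
    [IsProbabilityMeasure μ] {K : Ω → ℝ} (hK : Integrable K μ) :
    ENNReal.ofReal (Real.exp (∫ x, K x ∂μ)) ≤ ∫⁻ x, ENNReal.ofReal (Real.exp (K x)) ∂μ := by
  by_cases h : Integrable (fun x => Real.exp (K x)) μ
  · rw [← ofReal_integral_eq_lintegral_ofReal h (.of_forall fun _ => (Real.exp_pos _).le)]
    exact ENNReal.ofReal_le_ofReal (convexOn_exp.map_integral_le Real.continuous_exp.continuousOn
      isClosed_univ (.of_forall fun _ => Set.mem_univ _) hK h)
  · have h' : ¬ HasFiniteIntegral (fun x => Real.exp (K x)) μ := fun hf =>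
      h ⟨Real.continuous_exp.comp_aestronglyMeasurable hK.1, hf⟩
    rw [hasFiniteIntegral_iff_ofReal (.of_forall fun _ => (Real.exp_pos _).le)] at h'
    rw [not_lt_top_iff.1 h']
    exact le_top

variable {E : Type*} [NormedAddCommGroup E] [InnerProductSpace ℝ E] [FiniteDimensional ℝ E]
  [MeasurableSpace E] [BorelSpace E]

/-- Translate by `a`, then apply Jensen; the linear term of the density averages to zero. What
remains, `‖a‖² / 2`, is the relative entropy of the translate. -/
lemma ofReal_exp_integral_shift_le {Φ : E → ℝ} (a : E)
    (hΦ : Integrable (fun g => Φ (g + a)) (gaussianPrior E)) :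
    ENNReal.ofReal (Real.exp (∫ g, Φ (g + a) ∂gaussianPrior E - ‖a‖ ^ 2 / 2)) ≤
      ∫⁻ g, ENNReal.ofReal (Real.exp (Φ g)) ∂gaussianPrior E := by
  rw [lintegral_gaussianPrior_shift a]
  have hi : Integrable (fun g : E => -inner ℝ g a - ‖a‖ ^ 2 / 2) (gaussianPrior E) :=
    (integrable_inner_gaussianPrior a).neg.sub (integrable_const _)
  have h := ofReal_exp_integral_le_lintegral (hi.add hΦ)
  refine le_trans (le_of_eq ?_) (h.trans (le_of_eq ?_))
  · simp only [Pi.add_apply]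
    rw [integral_add hi hΦ, integral_sub
      (by exact (integrable_inner_gaussianPrior a).neg) (integrable_const _), integral_neg, integral_inner_gaussianPrior]
    simp only [integral_const, probReal_univ, smul_eq_mul, one_mul]
    congr 2
    ring
  · refine lintegral_congr fun g => ?_
    rw [← ENNReal.ofReal_mul (by positivity), ← Real.exp_add]
    rfl

lemma measure_exp_le_le {Ω : Type*} [MeasurableSpace Ω] {P : Measure Ω} {F : Ω → ENNReal}
    (hF : Measurable F) (h : ∫⁻ S, F S ∂P ≤ 1) {δ : ℝ} (hδ : 0 < δ) :
    P {S | F S < ENNReal.ofReal (1 / δ)}ᶜ ≤ ENNReal.ofReal δ := by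
  have h1 := (mul_meas_ge_le_lintegral₀ hF.aemeasurable (ENNReal.ofReal (1 / δ))).trans h
  have h2 : {S | F S < ENNReal.ofReal (1 / δ)}ᶜ = {S | ENNReal.ofReal (1 / δ) ≤ F S} := by
    ext; simp
  rw [h2]
  calc P {S | ENNReal.ofReal (1 / δ) ≤ F S}
      = ENNReal.ofReal δ * (ENNReal.ofReal (1 / δ) * P {S | ENNReal.ofReal (1 / δ) ≤ F S}) := by
        rw [← mul_assoc, ← ENNReal.ofReal_mul hδ.le, mul_one_div_cancel hδ.ne']
        simp
    _ ≤ ENNReal.ofReal δ * 1 := by gcongr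
    _ = _ := mul_one _

/-- A PAC-Bayesian inequality with Gaussian prior and posteriors. -/
theorem pacBayes {Ω : Type*} [MeasurableSpace Ω] (P : Measure Ω) [SFinite P] {Φ : Ω → E → ℝ}
    (hΦ : Measurable (Function.uncurry Φ))
    (h : ∀ g, ∫⁻ S, ENNReal.ofReal (Real.exp (Φ S g)) ∂P ≤ 1) {δ : ℝ} (hδ : 0 < δ) :
    ∃ G : Set Ω, MeasurableSet G ∧ P Gᶜ ≤ ENNReal.ofReal δ ∧ ∀ S ∈ G, ∀ a : E,
      Integrable (fun g => Φ S (g + a)) (gaussianPrior E) →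
      ∫ g, Φ S (g + a) ∂gaussianPrior E ≤ ‖a‖ ^ 2 / 2 + Real.log (1 / δ) := by
  have hm : Measurable (Function.uncurry fun S g => ENNReal.ofReal (Real.exp (Φ S g))) :=
    (Real.measurable_exp.comp hΦ).ennreal_ofReal
  have hF : Measurable fun S => ∫⁻ g, ENNReal.ofReal (Real.exp (Φ S g)) ∂gaussianPrior E :=
    hm.lintegral_prod_right'
  -- The event concerns only the average over the prior, so one use of Markov's inequality serves
  -- all `a` at once, including those that depend on the sample.
  refine ⟨{S | ∫⁻ g, ENNReal.ofReal (Real.exp (Φ S g)) ∂gaussianPrior E < ENNReal.ofReal (1 / δ)},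
    measurableSet_lt hF measurable_const, measure_exp_le_le hF ?_ hδ, fun S hS a ha => ?_⟩
  · rw [lintegral_lintegral_swap hm.aemeasurable]
    calc _ ≤ ∫⁻ _, 1 ∂gaussianPrior E := lintegral_mono h
      _ = 1 := by simp
  · have h1 := (ofReal_exp_integral_shift_le a ha).trans_lt hS
    rw [ENNReal.ofReal_lt_ofReal_iff (by positivity), ← Real.lt_log_iff_exp_lt (by positivity)] at h1
    linarith

end ChangeOfMeasure

/-! ### Exponential moments of i.i.d. sums. -/

section IndependentSample

variable {Z : Type*} [MeasurableSpace Z] {D : Measure Z} [IsProbabilityMeasure D] {m : ℕ}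

lemma lintegral_exp_sum_pi {f : Z → ℝ} (hf : Measurable f) :
    ∫⁻ S : Fin m → Z, ENNReal.ofReal (Real.exp (∑ i, f (S i))) ∂(Measure.pi fun _ => D) =
      (∫⁻ z, ENNReal.ofReal (Real.exp (f z)) ∂D) ^ m := by
  have h1 : ∀ S : Fin m → Z, ENNReal.ofReal (Real.exp (∑ i, f (S i))) =
      ∏ i, ENNReal.ofReal (Real.exp (f (S i))) := fun S => by
    rw [Real.exp_sum, ENNReal.ofReal_prod_of_nonneg fun _ _ => (Real.exp_pos _).le]
  simp only [h1]
  have hm : Measurable fun z => ENNReal.ofReal (Real.exp (f z)) := by fun_prop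
  have hi := ProbabilityTheory.iIndepFun_pi (μ := fun _ : Fin m => D)
    (X := fun _ z => ENNReal.ofReal (Real.exp (f z))) fun _ => hm.aemeasurable
  rw [ProbabilityTheory.lintegral_prod_eq_prod_lintegral_of_indepFun _ _ hi fun i => by fun_prop]
  have h2 : ∀ i : Fin m, ∫⁻ S : Fin m → Z, ENNReal.ofReal (Real.exp (f (S i)))
      ∂(Measure.pi fun _ => D) = ∫⁻ z, ENNReal.ofReal (Real.exp (f z)) ∂D := fun i =>
    (measurePreserving_eval (fun _ : Fin m => D) i).lintegral_comp hm
  simp [h2]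

lemma lintegral_exp_sum_pi_le_one {f : Z → ℝ} (hf : Measurable f)
    (h : ∫⁻ z, ENNReal.ofReal (Real.exp (f z)) ∂D ≤ 1) :
    ∫⁻ S : Fin m → Z, ENNReal.ofReal (Real.exp (∑ i, f (S i))) ∂(Measure.pi fun _ => D) ≤ 1 := by
  rw [lintegral_exp_sum_pi hf]
  exact pow_le_one₀ zero_le h

lemma exists_measurableSet_sum_le {f : Z → ℝ} (hf : Measurable f)
    (h : ∫⁻ z, ENNReal.ofReal (Real.exp (f z)) ∂D ≤ 1) {δ : ℝ} (hδ : 0 < δ) :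
    ∃ G : Set (Fin m → Z), MeasurableSet G ∧
      (Measure.pi fun _ => D) Gᶜ ≤ ENNReal.ofReal δ ∧
      ∀ S ∈ G, ∑ i, f (S i) ≤ Real.log (1 / δ) := by
  have hF : Measurable fun S : Fin m → Z => ENNReal.ofReal (Real.exp (∑ i, f (S i))) := by
    fun_prop
  refine ⟨_, measurableSet_lt hF measurable_const,
    measure_exp_le_le hF (lintegral_exp_sum_pi_le_one hf h) hδ, fun S hS => ?_⟩
  rw [Set.mem_ofPred_eq, ENNReal.ofReal_lt_ofReal_iff (by positivity),
    ← Real.lt_log_iff_exp_lt (by positivity)] at hS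
  exact hS.le

omit [IsProbabilityMeasure D] in
lemma lintegral_ofReal_exp_le {f g : Z → ℝ} (hf : ∀ z, Real.exp (f z) ≤ g z)
    (hg : Integrable g D) {r : ℝ} (h : ∫ z, g z ∂D ≤ r) :
    ∫⁻ z, ENNReal.ofReal (Real.exp (f z)) ∂D ≤ ENNReal.ofReal r := by
  calc ∫⁻ z, ENNReal.ofReal (Real.exp (f z)) ∂D ≤ ∫⁻ z, ENNReal.ofReal (g z) ∂D :=
        lintegral_mono fun z => ENNReal.ofReal_le_ofReal (hf z)
    _ = ENNReal.ofReal (∫ z, g z ∂D) := (ofReal_integral_eq_lintegral_ofReal hg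
        (.of_forall fun z => (Real.exp_pos _).le.trans (hf z))).symm
    _ ≤ _ := ENNReal.ofReal_le_ofReal h

end IndependentSample

/-! ### Orthogonality of the residual `y - c x` to functions of `x`. -/

section ConditionalMean

variable {X : Type*} [MeasurableSpace X] {D : Measure (X × unitInterval)} [IsProbabilityMeasure D]
  {c : X → unitInterval}

lemma abs_coe_sub_coe_le_one (a b : unitInterval) : |(a : ℝ) - b| ≤ 1 := by
  rw [abs_le]
  constructor <;> linarith [a.2.1, a.2.2, b.2.1, b.2.2]

lemma integrable_mul_residual (hc : Measurable c) {k : X → ℝ} (hk : Measurable k)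
    {M : ℝ} (hM : ∀ x, |k x| ≤ M) :
    Integrable (fun p : X × unitInterval => k p.1 * ((p.2 : ℝ) - c p.1)) D := by
  refine Integrable.of_bound (C := M) (by fun_prop) (.of_forall fun p => ?_)
  rw [Real.norm_eq_abs, abs_mul]
  have := abs_coe_sub_coe_le_one p.2 (c p.1)
  nlinarith [hM p.1, abs_nonneg (k p.1), abs_nonneg ((p.2 : ℝ) - c p.1)]

/-- The factor `k` can be pulled out of the conditional expectation given `x`. This removes the
terms linear in the residual from the exponential moment bounds. -/
lemma integral_mul_residual (hc : IsConditionalMean D c) {k : X → ℝ} (hk : Measurable k)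
    {M : ℝ} (hM : ∀ x, |k x| ≤ M) :
    ∫ p, k p.1 * ((p.2 : ℝ) - c p.1) ∂D = 0 := by
  have hcm := hc.1
  have hm : MeasurableSpace.comap (Prod.fst : X × unitInterval → X) inferInstance ≤
      (inferInstance : MeasurableSpace (X × unitInterval)) := measurable_fst.comap_le
  have hb : ∀ {f : X × unitInterval → unitInterval}, Measurable f →
      Integrable (fun p => k p.1 * (f p : ℝ)) D := fun {f} hf => by
    refine Integrable.of_bound (C := M) (by fun_prop) (.of_forall fun p => ?_)
    rw [Real.norm_eq_abs, abs_mul, abs_of_nonneg (f p).2.1]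
    nlinarith [hM p.1, abs_nonneg (k p.1), (f p).2.1, (f p).2.2]
  have hy : Integrable (fun p : X × unitInterval => (p.2 : ℝ)) D :=
    Integrable.of_bound (C := 1) (by fun_prop) (.of_forall fun p => by
      rw [Real.norm_eq_abs, abs_of_nonneg p.2.2.1]; exact p.2.2.2)
  have hks : StronglyMeasurable[MeasurableSpace.comap (Prod.fst : X × unitInterval → X)
      inferInstance] (fun p : X × unitInterval => k p.1) :=
    (hk.comp (comap_measurable _)).stronglyMeasurable
  have h1 := condExp_mul_of_stronglyMeasurable_left (μ := D)
    (g := fun p : X × unitInterval => (p.2 : ℝ)) hks (hb measurable_snd) hy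
  have h2 : ∫ p, k p.1 * (p.2 : ℝ) ∂D = ∫ p, k p.1 * (c p.1 : ℝ) ∂D := by
    rw [← integral_condExp hm]
    refine integral_congr_ae ?_
    filter_upwards [h1, hc.2] with p hp1 hp2
    refine hp1.trans ?_
    simp only [Pi.mul_apply, hp2]
  simp only [mul_sub]
  rw [integral_sub (hb measurable_snd) (by exact hb (hcm.comp measurable_fst)), h2, sub_self]

end ConditionalMean

/-! ### Concentration on the training sample. -/

section TrainingEvents

variable {X E : Type*} [MeasurableSpace X] [NormedAddCommGroup E] [InnerProductSpace ℝ E]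
  [FiniteDimensional ℝ E] [MeasurableSpace E] [BorelSpace E]
  {D : Measure (X × unitInterval)} [IsProbabilityMeasure D] {c : X → unitInterval} {ψ : X → E}
  {m : ℕ}

lemma abs_sinh_mul_exp_le (s : ℝ) : |Real.sinh s * Real.exp (-(s ^ 2 / 2))| ≤ 1 := by
  rw [abs_mul, abs_of_pos (Real.exp_pos _), Real.exp_neg, ← div_eq_mul_inv,
    div_le_one (Real.exp_pos _)]
  refine le_trans ?_ (Real.cosh_le_exp_half_sq s)
  rw [Real.abs_sinh, ← Real.cosh_abs s]
  exact (Real.sinh_lt_cosh _).le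

/-- Convexity gives `exp (s z) ≤ cosh s + z sinh s`, and `cosh s ≤ exp (s² / 2)`. The bound is kept
linear in `z` so that it integrates to 1 when `z` is a residual. -/
lemma exp_mul_sub_half_sq_le {z : ℝ} (hz : |z| ≤ 1) (s : ℝ) :
    Real.exp (s * z - s ^ 2 / 2) ≤ 1 + Real.sinh s * Real.exp (-(s ^ 2 / 2)) * z := by
  have h1 : Real.exp (s * z) ≤ Real.cosh s + z * Real.sinh s := by
    simpa [mul_comm] using Real.exp_mul_le_cosh_add_mul_sinh hz s
  have h2 := Real.cosh_le_exp_half_sq s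
  have h3 : Real.exp (s ^ 2 / 2) * Real.exp (-(s ^ 2 / 2)) = 1 := by
    rw [← Real.exp_add]; simp
  rw [sub_eq_add_neg, Real.exp_add]
  nlinarith [Real.exp_pos (-(s ^ 2 / 2))]

/-- The noise vector of the training sample is small. -/
lemma exists_measurableSet_norm_residual_le (hc : IsConditionalMean D c) (hψ : Measurable ψ)
    (hψ1 : ∀ x, ‖ψ x‖ ≤ 1) {lam δ : ℝ} (hlam : 0 < lam) (hδ : 0 < δ) :
    ∃ G : Set (Fin m → X × unitInterval), MeasurableSet G ∧
      (Measure.pi fun _ => D) Gᶜ ≤ ENNReal.ofReal δ ∧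
      ∀ S ∈ G, ‖∑ i, (((S i).2 : ℝ) - c (S i).1) • ψ (S i).1‖ ≤
        3 * lam * m + (1 / 2 + Real.log (1 / δ)) / lam := by
  have hcm := hc.1
  -- The subtracted square compensates the variance, so that `exp Φ` has mean at most 1 for each
  -- `g`.
  set Φ : (Fin m → X × unitInterval) → E → ℝ := fun S g =>
    ∑ i, (lam * inner ℝ g (ψ (S i).1) * (((S i).2 : ℝ) - c (S i).1) -
      (lam * inner ℝ g (ψ (S i).1)) ^ 2 / 2) with hΦ
  have hΦm : Measurable (Function.uncurry Φ) := by
    simp only [hΦ, Function.uncurry_def]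
    fun_prop
  obtain ⟨G, hG, hGδ, hGS⟩ := pacBayes (Measure.pi fun _ => D) hΦm (fun g => by
    refine lintegral_exp_sum_pi_le_one (D := D) (f := fun p =>
      lam * inner ℝ g (ψ p.1) * ((p.2 : ℝ) - c p.1) - (lam * inner ℝ g (ψ p.1)) ^ 2 / 2)
      (by fun_prop) ?_
    have hk : Measurable fun x => Real.sinh (lam * inner ℝ g (ψ x)) *
      Real.exp (-((lam * inner ℝ g (ψ x)) ^ 2 / 2)) := by
      have := Real.measurable_sinh
      fun_prop
    have hi := integrable_mul_residual (D := D) hcm hk fun x => abs_sinh_mul_exp_le _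
    have h := lintegral_ofReal_exp_le (D := D) (r := 1)
      (fun p : X × unitInterval => exp_mul_sub_half_sq_le
        (abs_coe_sub_coe_le_one p.2 (c p.1)) (lam * inner ℝ g (ψ p.1)))
      ((integrable_const _).add hi)
      (by
        rw [integral_add (integrable_const _) hi,
          integral_mul_residual hc hk fun x => abs_sinh_mul_exp_le _]
        simp)
    simpa using h) hδ
  refine ⟨G, hG, hGδ, fun S hS => ?_⟩
  set v : E := ∑ i, (((S i).2 : ℝ) - c (S i).1) • ψ (S i).1 with hv
  -- Averaging over `g` removes `⟨g, v⟩`, and each compensator has `E ⟨g + a, b⟩² ≤ 2 · 2 + 2 = 6`,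
  -- whence the 3.
  have hlog : ∀ a : E, ‖a‖ ≤ 1 → lam * inner ℝ a v ≤
      3 * lam ^ 2 * m + ‖a‖ ^ 2 / 2 + Real.log (1 / δ) := fun a ha => by
    have e1 : ∀ g : E, Φ S (g + a) = lam * inner ℝ g v + lam * inner ℝ a v -
        ∑ i, lam ^ 2 / 2 * (inner ℝ (g + a) (ψ (S i).1)) ^ 2 := fun g => by
      rw [← mul_add, ← inner_add_left]
      simp only [hΦ, hv, Finset.sum_sub_distrib, inner_sum,
        inner_smul_right]
      congr 1
      · rw [Finset.mul_sum]
        exact Finset.sum_congr rfl fun i _ => by ring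
      · exact Finset.sum_congr rfl fun i _ => by ring
    have hq : ∀ b : E, Integrable (fun g : E => (inner ℝ (g + a) b : ℝ) ^ 2)
        (gaussianPrior E) := fun b => by
      simp only [inner_add_left, add_sq]
      exact ((integrable_inner_sq_gaussianPrior b).add
        (((integrable_inner_gaussianPrior b).const_mul 2).mul_const _)).add (integrable_const _)
    have hq3 : ∀ b : E, ‖b‖ ≤ 1 → ∫ g, (inner ℝ (g + a) b : ℝ) ^ 2 ∂gaussianPrior E ≤ 6 :=
      fun b hb => by
      have hab : (inner ℝ a b : ℝ) ^ 2 ≤ 1 := by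
        have := abs_real_inner_le_norm a b
        rw [← sq_abs]
        have h0 := abs_nonneg (inner ℝ a b : ℝ)
        have : |(inner ℝ a b : ℝ)| ≤ 1 :=
          this.trans (mul_le_one₀ ha (norm_nonneg _) hb)
        nlinarith
      calc ∫ g, (inner ℝ (g + a) b : ℝ) ^ 2 ∂gaussianPrior E
          ≤ ∫ g, (2 * (inner ℝ g b : ℝ) ^ 2 + 2) ∂gaussianPrior E := by
            refine integral_mono (hq b) (((integrable_inner_sq_gaussianPrior b).const_mul 2).add
              (integrable_const _)) fun g => ?_
            simp only [inner_add_left]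
            nlinarith [sq_nonneg ((inner ℝ g b : ℝ) - inner ℝ a b)]
        _ = 2 * ∫ g, (inner ℝ g b : ℝ) ^ 2 ∂gaussianPrior E + 2 := by
            rw [integral_add ((integrable_inner_sq_gaussianPrior b).const_mul 2)
              (integrable_const _), integral_const_mul]
            simp
        _ ≤ 6 := by linarith [integral_inner_sq_gaussianPrior_le hb]
    have hi1 : Integrable (fun g : E => lam * inner ℝ g v + lam * inner ℝ a v)
        (gaussianPrior E) :=
      ((integrable_inner_gaussianPrior v).const_mul lam).add (integrable_const _)
    have hi2 : ∀ i ∈ Finset.univ, Integrable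
        (fun g : E => lam ^ 2 / 2 * (inner ℝ (g + a) (ψ (S i).1) : ℝ) ^ 2) (gaussianPrior E) :=
      fun i _ => (hq _).const_mul _
    have h := hGS S hS a (by
      simp only [e1]
      exact hi1.sub (integrable_finsetSum _ hi2))
    simp only [e1] at h
    rw [integral_sub hi1 (integrable_finsetSum _ hi2), integral_finsetSum _ hi2,
      integral_add ((integrable_inner_gaussianPrior v).const_mul lam) (integrable_const _),
      integral_const_mul, integral_inner_gaussianPrior] at h
    simp only [integral_const, probReal_univ, smul_eq_mul, one_mul, mul_zero, zero_add,
      integral_const_mul] at h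
    have h6 : ∑ i, lam ^ 2 / 2 * ∫ g, (inner ℝ (g + a) (ψ (S i).1) : ℝ) ^ 2 ∂gaussianPrior E ≤
        ∑ _i : Fin m, lam ^ 2 / 2 * 6 := by
      gcongr with i
      exact hq3 _ (hψ1 _)
    simp only [Finset.sum_const, Finset.card_univ, Fintype.card_fin, nsmul_eq_mul] at h6
    linarith
  -- Take `a = v / ‖v‖`, a direction that depends on the sample.
  have hfin : lam * ‖v‖ ≤ 3 * lam ^ 2 * m + 1 / 2 + Real.log (1 / δ) := by
    by_cases hv0 : v = 0
    · have := hlog 0 (by simp)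
      simp only [inner_zero_left, norm_zero] at this
      rw [hv0, norm_zero]
      norm_num at this ⊢
      linarith
    · have hvn : 0 < ‖v‖ := norm_pos_iff.2 hv0
      have hn : ‖(‖v‖⁻¹ • v)‖ = 1 := by
        rw [norm_smul, norm_inv, norm_norm, inv_mul_cancel₀ hvn.ne']
      have := hlog (‖v‖⁻¹ • v) hn.le
      rw [hn, inner_smul_left, real_inner_self_eq_norm_sq] at this
      simp only [conj_trivial] at this
      rw [show ‖v‖⁻¹ * ‖v‖ ^ 2 = ‖v‖ by field_simp] at this
      linarith
  calc ‖v‖ = lam * ‖v‖ / lam := by field_simp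
    _ ≤ (3 * lam ^ 2 * m + 1 / 2 + Real.log (1 / δ)) / lam := by gcongr
    _ = _ := by field_simp; ring

/-- The empirical second moment of a bounded function is controlled by its second moment. -/
lemma exists_measurableSet_sum_sq_le {ξ : X → ℝ} (hξ : Measurable ξ) {ζ ε δ : ℝ} (hζ : 0 < ζ)
    (hξζ : ∀ x, |ξ x| ≤ ζ) (hε : ∫ p, ξ p.1 ^ 2 ∂D ≤ ε) (hδ : 0 < δ) :
    ∃ G : Set (Fin m → X × unitInterval), MeasurableSet G ∧
      (Measure.pi fun _ => D) Gᶜ ≤ ENNReal.ofReal δ ∧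
      ∀ S ∈ G, ∑ i, ξ (S i).1 ^ 2 ≤ 2 * m * ε + ζ ^ 2 * Real.log (1 / δ) := by
  have hsq : ∀ x, ξ x ^ 2 ≤ ζ ^ 2 := fun x => sq_le_sq' (abs_le.1 (hξζ x)).1 (abs_le.1 (hξζ x)).2
  have hi : Integrable (fun p : X × unitInterval => ξ p.1 ^ 2) D :=
    Integrable.of_bound (C := ζ ^ 2)
      ((hξ.comp measurable_fst).pow_const 2).aestronglyMeasurable (.of_forall fun p => by
      rw [Real.norm_of_nonneg (sq_nonneg _)]; exact hsq _)
  -- This makes the Chernoff bound multiplicative: twice the mean plus `ζ² log (1/δ)`, without a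
  -- term of order `√m`.
  have key : ∀ s : ℝ, 0 ≤ s → s ≤ 1 → Real.exp s ≤ 1 + 2 * s := fun s h0 h1 => by
    have h := Real.abs_exp_sub_one_sub_id_le (x := s) (by rwa [abs_of_nonneg h0])
    have := (abs_le.1 h).2
    nlinarith
  obtain ⟨G, hG, hGδ, hGS⟩ := exists_measurableSet_sum_le (D := D) (m := m)
    (f := fun p => ξ p.1 ^ 2 / ζ ^ 2 - 2 * ε / ζ ^ 2) (by fun_prop) (by
      have h := lintegral_ofReal_exp_le (D := D) (r := 1)
        (f := fun p : X × unitInterval => ξ p.1 ^ 2 / ζ ^ 2 - 2 * ε / ζ ^ 2)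
        (g := fun p => Real.exp (-(2 * ε / ζ ^ 2)) * (1 + 2 / ζ ^ 2 * ξ p.1 ^ 2))
        (fun p => by
          rw [sub_eq_neg_add, Real.exp_add]
          gcongr
          refine (key _ (by positivity) (by rw [div_le_one (by positivity)]; exact hsq _)).trans
            (le_of_eq (by ring)))
        (((integrable_const _).add (hi.const_mul _)).const_mul _)
        (by
          rw [integral_const_mul, integral_add (integrable_const _) (hi.const_mul _),
            integral_const_mul]
          simp only [integral_const, probReal_univ, smul_eq_mul, one_mul]
          have h1 : 1 + 2 / ζ ^ 2 * ∫ p, ξ p.1 ^ 2 ∂D ≤ 1 + 2 / ζ ^ 2 * ε := by gcongr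
          have h2 : 1 + 2 / ζ ^ 2 * ε ≤ Real.exp (2 * ε / ζ ^ 2) := by
            have := Real.add_one_le_exp (2 * ε / ζ ^ 2)
            refine le_trans (le_of_eq (by ring)) this
          rw [Real.exp_neg, inv_mul_le_iff₀ (Real.exp_pos _), mul_one]
          exact h1.trans h2)
      simpa using h) hδ
  refine ⟨G, hG, hGδ, fun S hS => ?_⟩
  have h := hGS S hS
  simp only [Finset.sum_sub_distrib, ← Finset.sum_div, Finset.sum_const, Finset.card_univ,
    Fintype.card_fin, nsmul_eq_mul] at h
  have h2 : ∑ i, ξ (S i).1 ^ 2 ≤ (Real.log (1 / δ) + m * (2 * ε / ζ ^ 2)) * ζ ^ 2 := by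
    rw [← div_le_iff₀ (by positivity), ← mul_div_assoc]
    linarith
  refine h2.trans (le_of_eq ?_)
  field_simp
  ring

end TrainingEvents

/-! ### Risk versus empirical risk, uniformly over the weights. -/

section UniformDeviation

variable {X E : Type*} [MeasurableSpace X] [NormedAddCommGroup E] [InnerProductSpace ℝ E]
  [MeasurableSpace E] [BorelSpace E]
  {D : Measure (X × unitInterval)} [IsProbabilityMeasure D] {c : X → unitInterval} {ψ : X → E}
  {m : ℕ} {u : ℝ → unitInterval} {L : ℝ}

lemma abs_coe_sub_le_of_lipschitz (hL : 0 ≤ L) (hu : LipschitzWith L.toNNReal u) (s t : ℝ) :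
    |(u s : ℝ) - u t| ≤ L * |s - t| := by
  have h := hu.dist_le_mul s t
  rwa [Subtype.dist_eq, Real.dist_eq, Real.dist_eq, Real.coe_toNNReal _ hL] at h

/-- The squared distance at `x` of the linear predictor `w` to the concept. -/
def predictorLoss (u : ℝ → unitInterval) (ψ : X → E) (c : X → unitInterval) (w : E) (x : X) : ℝ :=
  ((u (inner ℝ w (ψ x)) : ℝ) - c x) ^ 2

omit [MeasurableSpace X] [MeasurableSpace E] [BorelSpace E] in
lemma predictorLoss_nonneg (w : E) (x : X) : 0 ≤ predictorLoss u ψ c w x := sq_nonneg _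

omit [MeasurableSpace X] [MeasurableSpace E] [BorelSpace E] in
lemma predictorLoss_le_one (w : E) (x : X) : predictorLoss u ψ c w x ≤ 1 :=
  (sq_le_one_iff_abs_le_one _).2 (abs_coe_sub_coe_le_one _ _)

lemma measurable_predictorLoss [FiniteDimensional ℝ E] (hu : Continuous u) (hψ : Measurable ψ)
    (hc : Measurable c) :
    Measurable (Function.uncurry (predictorLoss u ψ c)) := by
  have := hu.measurable
  unfold predictorLoss
  simp only [Function.uncurry_def]
  fun_prop

omit [MeasurableSpace X] [MeasurableSpace E] [BorelSpace E] in
lemma predictorLoss_le (hL : 0 ≤ L) (hu : LipschitzWith L.toNNReal u) (w w' : E) (x : X) :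
    predictorLoss u ψ c w x ≤
      2 * predictorLoss u ψ c w' x + 2 * L ^ 2 * (inner ℝ (w' - w) (ψ x)) ^ 2 := by
  have h := abs_coe_sub_le_of_lipschitz hL hu (inner ℝ w (ψ x)) (inner ℝ w' (ψ x))
  have h2 : ((u (inner ℝ w (ψ x)) : ℝ) - u (inner ℝ w' (ψ x))) ^ 2 ≤
      L ^ 2 * (inner ℝ (w' - w) (ψ x)) ^ 2 := by
    rw [← sq_abs ((u _ : ℝ) - _), ← sq_abs (inner ℝ (w' - w) (ψ x)), ← mul_pow, inner_sub_left,
      abs_sub_comm (inner ℝ w' (ψ x))]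
    gcongr
  unfold predictorLoss
  nlinarith [sq_nonneg (((u (inner ℝ w (ψ x)) : ℝ) - u (inner ℝ w' (ψ x))) -
    ((u (inner ℝ w' (ψ x)) : ℝ) - c x))]

variable [FiniteDimensional ℝ E]

lemma integrable_predictorLoss_shift (hu : Continuous u) (hψ : Measurable ψ)
    (hc : Measurable c) (w : E) (σ : ℝ) (x : X) :
    Integrable (fun g => predictorLoss u ψ c (w + σ • g) x) (gaussianPrior E) := by
  have h := measurable_predictorLoss hu hψ hc
  refine Integrable.of_bound (C := 1) (h.comp (f := fun g => (w + σ • g, x))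
    (by fun_prop)).aestronglyMeasurable (.of_forall fun g => ?_)
  rw [Real.norm_of_nonneg (predictorLoss_nonneg _ _)]
  exact predictorLoss_le_one _ _

lemma integrable_predictorLoss (hu : Continuous u) (hψ : Measurable ψ)
    (hc : Measurable c) (w : E) :
    Integrable (fun p : X × unitInterval => predictorLoss u ψ c w p.1) D := by
  have h := measurable_predictorLoss hu hψ hc
  refine Integrable.of_bound (C := 1) (h.comp (f := fun p : X × unitInterval => (w, p.1))
    (by fun_prop)).aestronglyMeasurable (.of_forall fun g => ?_)
  rw [Real.norm_of_nonneg (predictorLoss_nonneg _ _)]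
  exact predictorLoss_le_one _ _

omit [MeasurableSpace X] in
lemma integral_smul_inner_sq_le {x : X} (hψ1 : ‖ψ x‖ ≤ 1) (σ : ℝ) :
    Integrable (fun g : E => (inner ℝ (σ • g) (ψ x) : ℝ) ^ 2) (gaussianPrior E) ∧
    ∫ g, (inner ℝ (σ • g) (ψ x) : ℝ) ^ 2 ∂gaussianPrior E ≤ 2 * σ ^ 2 := by
  simp only [inner_smul_left, conj_trivial, mul_pow]
  refine ⟨(integrable_inner_sq_gaussianPrior _).const_mul _, ?_⟩
  rw [integral_const_mul]
  nlinarith [integral_inner_sq_gaussianPrior_le hψ1, sq_nonneg σ]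

/-- Smoothing the weights perturbs only `⟨w, ψ x⟩`, by a variable of second moment at most `2σ²` in
any dimension. With the companion lower bound, the loss is kept up to a factor 2 and `O(L²σ²)`. -/
lemma integral_predictorLoss_shift_le (hL : 0 ≤ L) (hu : LipschitzWith L.toNNReal u)
    (hψ : Measurable ψ) (hψ1 : ∀ x, ‖ψ x‖ ≤ 1) (hc : Measurable c) (w : E) (σ : ℝ) (x : X) :
    ∫ g, predictorLoss u ψ c (w + σ • g) x ∂gaussianPrior E ≤
      2 * predictorLoss u ψ c w x + 4 * L ^ 2 * σ ^ 2 := by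
  obtain ⟨hi, hq⟩ := integral_smul_inner_sq_le (hψ1 x) σ
  calc _ ≤ ∫ g, (2 * predictorLoss u ψ c w x + 2 * L ^ 2 * (inner ℝ (σ • g) (ψ x)) ^ 2)
        ∂gaussianPrior E := by
        refine integral_mono (integrable_predictorLoss_shift hu.continuous hψ hc w σ x)
          ((integrable_const _).add (hi.const_mul _)) fun g => ?_
        refine (predictorLoss_le hL hu _ w x).trans (le_of_eq ?_)
        rw [sub_add_cancel_left, inner_neg_left, neg_sq]
    _ = 2 * predictorLoss u ψ c w x +
        2 * L ^ 2 * ∫ g, (inner ℝ (σ • g) (ψ x)) ^ 2 ∂gaussianPrior E := by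
        rw [integral_add (integrable_const _) (hi.const_mul _), integral_const_mul (2 * L ^ 2)]
        simp only [integral_const, probReal_univ, smul_eq_mul, one_mul]
    _ ≤ _ := by nlinarith [sq_nonneg L]

lemma le_integral_predictorLoss_shift (hL : 0 ≤ L) (hu : LipschitzWith L.toNNReal u)
    (hψ : Measurable ψ) (hψ1 : ∀ x, ‖ψ x‖ ≤ 1) (hc : Measurable c) (w : E) (σ : ℝ) (x : X) :
    predictorLoss u ψ c w x / 2 - 2 * L ^ 2 * σ ^ 2 ≤
      ∫ g, predictorLoss u ψ c (w + σ • g) x ∂gaussianPrior E := by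
  obtain ⟨hi, hq⟩ := integral_smul_inner_sq_le (hψ1 x) σ
  have h : predictorLoss u ψ c w x ≤ ∫ g, (2 * predictorLoss u ψ c (w + σ • g) x +
      2 * L ^ 2 * (inner ℝ (σ • g) (ψ x)) ^ 2) ∂gaussianPrior E := by
    calc predictorLoss u ψ c w x = ∫ _, predictorLoss u ψ c w x ∂gaussianPrior E := by simp
      _ ≤ _ := by
        refine integral_mono (integrable_const _)
          (((integrable_predictorLoss_shift hu.continuous hψ hc w σ x).const_mul _).add
            (hi.const_mul _)) fun g => ?_
        refine (predictorLoss_le hL hu _ (w + σ • g) x).trans (le_of_eq ?_)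
        rw [add_sub_cancel_left]
  rw [integral_add ((integrable_predictorLoss_shift hu.continuous hψ hc w σ x).const_mul _)
    (hi.const_mul _), integral_const_mul, integral_const_mul] at h
  nlinarith [sq_nonneg L]

/-- Uniformly over the weights, the risk is controlled by the empirical risk. -/
lemma exists_measurableSet_risk_le (hL : 0 ≤ L) (hu : LipschitzWith L.toNNReal u)
    (hψ : Measurable ψ) (hψ1 : ∀ x, ‖ψ x‖ ≤ 1) (hc : Measurable c) (v : E) {σ δ : ℝ}
    (hσ : 0 < σ) (hδ : 0 < δ) :
    ∃ G : Set (Fin m → X × unitInterval), MeasurableSet G ∧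
      (Measure.pi fun _ => D) Gᶜ ≤ ENNReal.ofReal δ ∧
      ∀ S ∈ G, ∀ w : E, m * ∫ p, predictorLoss u ψ c w p.1 ∂D ≤
        8 * ∑ i, predictorLoss u ψ c w (S i).1 + 20 * m * L ^ 2 * σ ^ 2 +
          2 * ‖w - v‖ ^ 2 / σ ^ 2 + 4 * Real.log (1 / δ) := by
  have hlm := measurable_predictorLoss hu.continuous hψ hc
  set R : E → ℝ := fun w => ∫ p, predictorLoss u ψ c w p.1 ∂D with hR
  have hRm : Measurable R := by
    have : Measurable (Function.uncurry fun (w : E) (p : X × unitInterval) =>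
        predictorLoss u ψ c w p.1) :=
      hlm.comp (f := fun q : E × X × unitInterval => (q.1, q.2.1)) (by fun_prop)
    exact this.stronglyMeasurable.integral_prod_right.measurable
  set Φ : (Fin m → X × unitInterval) → E → ℝ := fun S g =>
    ∑ i, (1 / 2 * R (v + σ • g) - predictorLoss u ψ c (v + σ • g) (S i).1) with hΦ
  have hΦm : Measurable (Function.uncurry Φ) := by
    refine Finset.measurable_fun_sum _ fun i _ => ?_
    refine ((hRm.comp (f := fun q : (Fin m → X × unitInterval) × E => v + σ • q.2)
      (by fun_prop)).const_mul _).sub (hlm.comp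
      (f := fun q : (Fin m → X × unitInterval) × E => (v + σ • q.2, (q.1 i).1)) (by fun_prop))
  -- The chord of `exp (-s)` lies below this line since `exp (-1) ≤ 1/2`. Comparing with half the
  -- risk gives a rate of order `1/m` instead of `1/√m`.
  have hexp : ∀ s : ℝ, 0 ≤ s → s ≤ 1 → Real.exp (-s) ≤ 1 - 1 / 2 * s := fun s h0 h1 => by
    have h := convexOn_exp.2 (Set.mem_univ 0) (Set.mem_univ (-1)) (sub_nonneg.2 h1) h0 (by ring)
    simp only [smul_eq_mul, mul_zero, zero_add, mul_neg, mul_one, Real.exp_zero] at h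
    nlinarith [Real.exp_neg_one_lt_d9]
  obtain ⟨G, hG, hGδ, hGS⟩ := pacBayes (Measure.pi fun _ => D) hΦm (fun g => by
    refine lintegral_exp_sum_pi_le_one (D := D) (f := fun p =>
      1 / 2 * R (v + σ • g) - predictorLoss u ψ c (v + σ • g) p.1)
      (measurable_const.sub (hlm.comp (f := fun p : X × unitInterval => (v + σ • g, p.1))
        (by fun_prop))) ?_
    have hi := integrable_predictorLoss (D := D) hu.continuous hψ hc (v + σ • g)
    have h := lintegral_ofReal_exp_le (D := D) (r := 1)
      (f := fun p => 1 / 2 * R (v + σ • g) - predictorLoss u ψ c (v + σ • g) p.1)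
      (g := fun p => Real.exp (1 / 2 * R (v + σ • g)) *
        (1 - 1 / 2 * predictorLoss u ψ c (v + σ • g) p.1))
      (fun p => by
        rw [sub_eq_add_neg, Real.exp_add]
        gcongr
        exact hexp _ (predictorLoss_nonneg _ _) (predictorLoss_le_one _ _))
      (((integrable_const _).sub (hi.const_mul _)).const_mul _)
      (by
        rw [integral_const_mul, integral_sub (integrable_const _) (hi.const_mul _),
          integral_const_mul]
        simp only [integral_const, probReal_univ, smul_eq_mul, one_mul]
        have h1 := Real.add_one_le_exp (-(1 / 2 * R (v + σ • g)))
        calc Real.exp (1 / 2 * R (v + σ • g)) * (1 - 1 / 2 * R (v + σ • g))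
            ≤ Real.exp (1 / 2 * R (v + σ • g)) * Real.exp (-(1 / 2 * R (v + σ • g))) := by
              gcongr; linarith
          _ = 1 := by rw [← Real.exp_add]; simp)
    simpa using h) hδ
  refine ⟨G, hG, hGδ, fun S hS w => ?_⟩
  -- This shift moves the centre of the prior from `v` to `w`.
  set a : E := σ⁻¹ • (w - v) with ha
  have hshift : ∀ g : E, v + σ • (g + a) = w + σ • g := fun g => by
    rw [ha, smul_add, smul_inv_smul₀ hσ.ne']; abel
  have hRi : Integrable (fun g => R (w + σ • g)) (gaussianPrior E) := by
    refine Integrable.of_bound (C := 1) (hRm.comp (f := fun g : E => w + σ • g)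
      (by fun_prop)).aestronglyMeasurable (.of_forall fun g => ?_)
    rw [Real.norm_of_nonneg (integral_nonneg fun p => predictorLoss_nonneg _ _)]
    calc R (w + σ • g) ≤ ∫ _, (1 : ℝ) ∂D :=
          integral_mono (integrable_predictorLoss hu.continuous hψ hc _) (integrable_const _)
            fun p => predictorLoss_le_one _ _
      _ = 1 := by simp
  have hli := integrable_predictorLoss_shift (σ := σ) (w := w) hu.continuous hψ hc
  have h := hGS S hS a (by
    simp only [hΦ, hshift]
    exact integrable_finsetSum _ fun i _ => (hRi.const_mul _).sub (hli _))
  simp only [hΦ, hshift] at h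
  rw [integral_finsetSum _ fun i _ => by exact (hRi.const_mul _).sub (hli _)] at h
  -- The term equals `R w / 4 - 2 * loss - 5L²σ²`; multiplying by 4 gives the constants of the
  -- statement.
  have hterm : ∀ i, ∫ g, (1 / 2 * R (w + σ • g) - predictorLoss u ψ c (w + σ • g) (S i).1)
      ∂gaussianPrior E ≥
      1 / 2 * (R w / 2 - 2 * L ^ 2 * σ ^ 2) -
        (2 * predictorLoss u ψ c w (S i).1 + 4 * L ^ 2 * σ ^ 2) := fun i => by
    rw [integral_sub (hRi.const_mul _) (hli _), integral_const_mul]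
    have h1 := integral_predictorLoss_shift_le hL hu hψ hψ1 hc w σ (S i).1
    have h2 : R w / 2 - 2 * L ^ 2 * σ ^ 2 ≤ ∫ g, R (w + σ • g) ∂gaussianPrior E := by
      have hint : Integrable (Function.uncurry fun (g : E) (p : X × unitInterval) =>
          predictorLoss u ψ c (w + σ • g) p.1) ((gaussianPrior E).prod D) := by
        refine Integrable.of_bound (C := 1) (hlm.comp
          (f := fun q : E × X × unitInterval => (w + σ • q.1, q.2.1))
          (by fun_prop)).aestronglyMeasurable (.of_forall fun q => ?_)
        change ‖predictorLoss u ψ c (w + σ • q.1) q.2.1‖ ≤ 1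
        rw [Real.norm_of_nonneg (predictorLoss_nonneg _ _)]
        exact predictorLoss_le_one _ _
      simp only [hR]
      rw [integral_integral_swap hint]
      have hi := integrable_predictorLoss (D := D) hu.continuous hψ hc w
      calc (∫ p, predictorLoss u ψ c w p.1 ∂D) / 2 - 2 * L ^ 2 * σ ^ 2
          = ∫ p, (predictorLoss u ψ c w p.1 / 2 - 2 * L ^ 2 * σ ^ 2) ∂D := by
            rw [integral_sub (hi.div_const _) (integrable_const _), integral_div]
            simp
        _ ≤ _ := integral_mono ((hi.div_const _).sub (integrable_const _))
            hint.integral_prod_right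
            fun p => le_integral_predictorLoss_shift hL hu hψ hψ1 hc w σ p.1
    linarith
  have hsum := (Finset.sum_le_sum fun i (_ : i ∈ Finset.univ) => hterm i).trans h
  simp only [Finset.sum_sub_distrib, Finset.sum_add_distrib, Finset.sum_const, Finset.card_univ,
    Fintype.card_fin, nsmul_eq_mul, ← Finset.mul_sum] at hsum
  have hna : ‖a‖ ^ 2 = ‖w - v‖ ^ 2 / σ ^ 2 := by
    rw [ha, norm_smul, norm_inv, Real.norm_of_nonneg hσ.le, mul_pow, inv_pow]
    field_simp
  rw [hna] at hsum
  have : 2 * ‖w - v‖ ^ 2 / σ ^ 2 = 2 * (‖w - v‖ ^ 2 / σ ^ 2) := by ring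
  rw [this]
  change m * R w ≤ _
  linarith

end UniformDeviation

/-! ### Comparison of two hypotheses on validation data. -/

section Validation

variable {X : Type*} [MeasurableSpace X] {D : Measure (X × unitInterval)} [IsProbabilityMeasure D]
  {c : X → unitInterval} {m : ℕ}

lemma integrable_sq_coe_sub_coe {h c : X → unitInterval} (hh : Measurable h) (hc : Measurable c) :
    Integrable (fun p : X × unitInterval => ((h p.1 : ℝ) - c p.1) ^ 2) D := by
  refine Integrable.of_bound (C := 1) (Measurable.aestronglyMeasurable (by fun_prop))
    (.of_forall fun p => ?_)
  rw [Real.norm_of_nonneg (sq_nonneg _)]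
  exact (sq_le_one_iff_abs_le_one _).2 (abs_coe_sub_coe_le_one _ _)

/-- Here `e` plays the conditional mean of the label `b`. The excess loss `Z` is `(a-e)² - (a'-e)²`
plus a term linear in `b - e`, and `Z² ≤ 8(a-e)² + 8(a'-e)²`. In `exp x ≤ 1 + x + x²` with `x =
-Z/16` the square costs `1/32` of each error, leaving `-1/32` and `3/32`: hence the factor 3 in the
selection. -/
lemma exp_neg_excess_loss_le {a a' b e : ℝ} (ha : a ∈ Set.Icc 0 1) (ha' : a' ∈ Set.Icc 0 1)
    (hb : b ∈ Set.Icc 0 1) :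
    Real.exp (-(1 / 16) * ((a - b) ^ 2 - (a' - b) ^ 2)) ≤
      1 + (-(1 / 32) * (a - e) ^ 2 + 3 / 32 * (a' - e) ^ 2) + 1 / 8 * (a - a') * (b - e) := by
  obtain ⟨h1, h2⟩ := ha
  obtain ⟨h3, h4⟩ := ha'
  obtain ⟨h5, h6⟩ := hb
  set Z := (a - b) ^ 2 - (a' - b) ^ 2 with hZ
  have hZe : Z = (a - a') * (a + a' - 2 * b) := by rw [hZ]; ring
  have hsum : |a + a' - 2 * b| ≤ 2 := by rw [abs_le]; constructor <;> linarith
  have hdiff : |a - a'| ≤ 1 := by rw [abs_le]; constructor <;> linarith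
  have hZ2 : |Z| ≤ 2 := by
    rw [hZe, abs_mul]
    nlinarith [abs_nonneg (a - a'), abs_nonneg (a + a' - 2 * b)]
  have hZsq : Z ^ 2 ≤ 8 * (a - e) ^ 2 + 8 * (a' - e) ^ 2 := by
    have h7 : Z ^ 2 ≤ 4 * (a - a') ^ 2 := by
      rw [hZe, mul_pow]
      have : (a + a' - 2 * b) ^ 2 ≤ 2 ^ 2 := sq_le_sq' (abs_le.1 hsum).1 (abs_le.1 hsum).2
      nlinarith [sq_nonneg (a - a')]
    nlinarith [sq_nonneg ((a - e) + (a' - e))]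
  have h := (abs_le.1 (Real.abs_exp_sub_one_sub_id_le (x := -(1 / 16) * Z) (by
    rw [abs_mul, abs_of_nonpos (by norm_num)]; linarith))).2
  have hZ3 : Z = (a - e) ^ 2 - (a' - e) ^ 2 - 2 * (a - a') * (b - e) := by rw [hZ]; ring
  nlinarith

/-- A hypothesis that is much worse than another one rarely has the smaller validation error. -/
lemma measure_validation_le_le (hc : IsConditionalMean D c) {h h' : X → unitInterval}
    (hh : Measurable h) (hh' : Measurable h') :
    (Measure.pi fun _ : Fin m => D) {V | ∑ j, ((h (V j).1 : ℝ) - (V j).2) ^ 2 ≤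
        ∑ j, ((h' (V j).1 : ℝ) - (V j).2) ^ 2} ≤
      ENNReal.ofReal (Real.exp (-(m * ((generalizationError D c h -
        3 * generalizationError D c h') / 32)))) := by
  have hcm := hc.1
  set κ := (generalizationError D c h - 3 * generalizationError D c h') / 32 with hκ
  set f : X × unitInterval → ℝ := fun p =>
    κ + -(1 / 16) * (((h p.1 : ℝ) - p.2) ^ 2 - ((h' p.1 : ℝ) - p.2) ^ 2) with hf
  have hfm : Measurable f := by fun_prop
  have hk : Measurable fun x => 1 / 8 * ((h x : ℝ) - h' x) := by fun_prop
  have hkb : ∀ x, |1 / 8 * ((h x : ℝ) - h' x)| ≤ 1 := fun x => by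
    rw [abs_mul, abs_of_nonneg (by norm_num)]
    linarith [abs_coe_sub_coe_le_one (h x) (h' x)]
  have hi1 := integrable_sq_coe_sub_coe (D := D) hh hcm
  have hi2 := integrable_sq_coe_sub_coe (D := D) hh' hcm
  have hi3 := integrable_mul_residual (D := D) hcm hk hkb
  have hi4 : Integrable (fun p : X × unitInterval => 1 + (-(1 / 32) * ((h p.1 : ℝ) - c p.1) ^ 2 +
      3 / 32 * ((h' p.1 : ℝ) - c p.1) ^ 2)) D :=
    (integrable_const _).add ((hi1.const_mul _).add (hi2.const_mul _))
  have hf1 : ∫⁻ p, ENNReal.ofReal (Real.exp (f p)) ∂D ≤ 1 := by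
    have := lintegral_ofReal_exp_le (D := D) (r := 1) (f := f)
      (g := fun p => Real.exp κ * (1 + (-(1 / 32) * ((h p.1 : ℝ) - c p.1) ^ 2 +
        3 / 32 * ((h' p.1 : ℝ) - c p.1) ^ 2) + 1 / 8 * ((h p.1 : ℝ) - h' p.1) *
          ((p.2 : ℝ) - c p.1)))
      (fun p => by
        rw [hf, Real.exp_add]
        gcongr
        exact exp_neg_excess_loss_le (h p.1).2 (h' p.1).2 p.2.2)
      ((hi4.add hi3).const_mul _)
      (by
        rw [integral_const_mul, integral_add hi4 hi3, integral_mul_residual hc hk hkb,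
          integral_add (integrable_const _) (by exact (hi1.const_mul _).add (hi2.const_mul _)),
          integral_add (hi1.const_mul _) (hi2.const_mul _), integral_const_mul (-(1 / 32)),
          integral_const_mul (3 / 32)]
        simp only [integral_const, probReal_univ, smul_eq_mul, one_mul, add_zero]
        change Real.exp κ * (1 + (-(1 / 32) * generalizationError D c h +
          3 / 32 * generalizationError D c h')) ≤ 1
        calc _ = Real.exp κ * (-κ + 1) := by rw [hκ]; ring
          _ ≤ Real.exp κ * Real.exp (-κ) := by gcongr; exact Real.add_one_le_exp _
          _ = 1 := by rw [← Real.exp_add]; simp)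
    simpa using this
  have hF : Measurable fun V : Fin m → X × unitInterval =>
      ENNReal.ofReal (Real.exp (∑ j, f (V j))) := by fun_prop
  refine (measure_mono fun V hV => ?_).trans
    (measure_exp_le_le hF (lintegral_exp_sum_pi_le_one hfm hf1) (Real.exp_pos (-(m * κ))))
  rw [Set.mem_compl_iff, Set.mem_ofPred_eq, not_lt]
  refine ENNReal.ofReal_le_ofReal ?_
  rw [one_div, ← Real.exp_neg, neg_neg, Real.exp_le_exp]
  simp only [hf, Finset.sum_add_distrib, Finset.sum_const, Finset.card_univ, Fintype.card_fin,
    nsmul_eq_mul, ← Finset.mul_sum, Finset.sum_sub_distrib]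
  have : ∑ j, ((h (V j).1 : ℝ) - (V j).2) ^ 2 ≤ ∑ j, ((h' (V j).1 : ℝ) - (V j).2) ^ 2 := hV
  linarith

end Validation

/-! ### Potential argument for the iterates. -/

section GradientDescent

variable {X E : Type*} [NormedAddCommGroup E] [InnerProductSpace ℝ E]
  {c : X → unitInterval} {ψ : X → E} {m : ℕ} {u : ℝ → unitInterval} {L : ℝ}

/-- The Alphatron iterates as vectors of the feature space. -/
noncomputable def weightVector (ψ : X → E) (u : ℝ → unitInterval) (lam : ℝ)
    (S : Fin m → X × unitInterval) : ℕ → E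
  | 0 => 0
  | t + 1 => weightVector ψ u lam S t + (lam / m) • ∑ i,
      (((S i).2 : ℝ) - u (inner ℝ (weightVector ψ u lam S t) (ψ (S i).1))) • ψ (S i).1

/-- Co-coercivity: by monotonicity `u s - u t` and `s - t` have the same sign, and one factor `|s -
t|` is at least `|u s - u t| / L`. -/
lemma sub_mul_sub_le_neg_sq (hL : 0 < L) (hu : LipschitzWith L.toNNReal u) (hmono : Monotone u)
    (s t : ℝ) : ((u s : ℝ) - u t) * (t - s) ≤ -(((u s : ℝ) - u t) ^ 2 / L) := by
  have h := abs_coe_sub_le_of_lipschitz hL.le hu s t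
  have h2 : ((u s : ℝ) - u t) ^ 2 ≤ L * (((u s : ℝ) - u t) * (s - t)) := by
    rcases le_total s t with hst | hst
    · have h3 : (u s : ℝ) ≤ u t := hmono hst
      rw [abs_of_nonpos (by linarith), abs_of_nonpos (by linarith)] at h
      nlinarith
    · have h3 : (u t : ℝ) ≤ u s := hmono hst
      rw [abs_of_nonneg (by linarith), abs_of_nonneg (by linarith)] at h
      nlinarith
  have h4 : ((u s : ℝ) - u t) ^ 2 / L ≤ ((u s : ℝ) - u t) * (s - t) := by
    rw [div_le_iff₀ hL]; linarith
  linarith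

lemma norm_sum_smul_sq_le {a : Fin m → ℝ} {p : Fin m → E} (hp : ∀ i, ‖p i‖ ≤ 1) :
    ‖∑ i, a i • p i‖ ^ 2 ≤ m * ∑ i, a i ^ 2 := by
  have h1 : ‖∑ i, a i • p i‖ ≤ ∑ i, |a i| := by
    refine (norm_sum_le _ _).trans (Finset.sum_le_sum fun i _ => ?_)
    rw [norm_smul, Real.norm_eq_abs]
    exact mul_le_of_le_one_right (abs_nonneg _) (hp i)
  calc ‖∑ i, a i • p i‖ ^ 2 ≤ (∑ i, |a i|) ^ 2 := by gcongr
    _ ≤ m * ∑ i, |a i| ^ 2 := by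
      simpa using sq_sum_le_card_mul_sum_sq (s := Finset.univ) (f := fun i => |a i|)
    _ = _ := by simp only [sq_abs]

variable {v : E} {ξ : X → ℝ} {B η ρ : ℝ} {S : Fin m → X × unitInterval}

/-- Expand the square, with the step split into noise `N` and signal `M`. Co-coercivity gives the
cross term `-(7/4) e/L²`, the other eighth paying for `ξ`; the squared step costs at most `(5/4)
e/L²` plus noise. The balance is `-e/(2L²)`. -/
lemma norm_sub_sq_step_le (hL : 0 < L) (hu : LipschitzWith L.toNNReal u) (hmono : Monotone u)
    (hψ1 : ∀ x, ‖ψ x‖ ≤ 1) (hc : c = fun x => u (inner ℝ v (ψ x) + ξ x)) (hm : 0 < m)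
    (hη : ‖∑ i, (((S i).2 : ℝ) - c (S i).1) • ψ (S i).1‖ ≤ m * η)
    (hρ : ∑ i, ξ (S i).1 ^ 2 ≤ m * ρ) (t : ℕ)
    (hB : ‖weightVector ψ u (1 / L) S t - v‖ ≤ B) :
    ‖weightVector ψ u (1 / L) S (t + 1) - v‖ ^ 2 ≤
      ‖weightVector ψ u (1 / L) S t - v‖ ^ 2 -
        ((∑ i, predictorLoss u ψ c (weightVector ψ u (1 / L) S t) (S i).1) / m / (2 * L ^ 2) -
          4 * ρ - 2 * η * B / L - 5 * η ^ 2 / L ^ 2) := by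
  set w := weightVector ψ u (1 / L) S t with hw
  have hm' : (0 : ℝ) < m := Nat.cast_pos.2 hm
  set N : E := ∑ i, (((S i).2 : ℝ) - c (S i).1) • ψ (S i).1 with hN
  set a : Fin m → ℝ := fun i => (c (S i).1 : ℝ) - u (inner ℝ w (ψ (S i).1)) with ha
  set M : E := ∑ i, a i • ψ (S i).1 with hM
  set e : ℝ := (∑ i, predictorLoss u ψ c w (S i).1) / m with he
  have hsum : ∑ i, a i ^ 2 = m * e := by
    rw [he, mul_div_cancel₀ _ hm'.ne']
    refine Finset.sum_congr rfl fun i _ => ?_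
    simp only [ha, predictorLoss]
    ring
  have hη0 : 0 ≤ η := by
    have := (norm_nonneg _).trans hη
    exact nonneg_of_mul_nonneg_right this hm'
  have hstep : weightVector ψ u (1 / L) S (t + 1) - v = (w - v) + (1 / L / m) • (N + M) := by
    rw [weightVector, ← hw, hN, hM, ← Finset.sum_add_distrib, add_sub_right_comm]
    congr 2
    refine Finset.sum_congr rfl fun i _ => ?_
    rw [← add_smul]
    congr 1
    simp only [ha]
    ring
  have hB0 : 0 ≤ B := (norm_nonneg _).trans hB
  have hNinner : inner ℝ (w - v) N ≤ m * (B * η) := by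
    calc inner ℝ (w - v) N ≤ ‖w - v‖ * ‖N‖ := real_inner_le_norm _ _
      _ ≤ B * (m * η) := by gcongr
      _ = _ := by ring
  have hMinner : inner ℝ (w - v) M ≤ m * (-(7 / 8 * e / L) + 2 * L * ρ) := by
    have hterm : ∀ i, a i * inner ℝ (w - v) (ψ (S i).1) ≤
        -(7 / 8 / L) * a i ^ 2 + 2 * L * ξ (S i).1 ^ 2 := fun i => by
      have h1 := sub_mul_sub_le_neg_sq hL hu hmono (inner ℝ v (ψ (S i).1) + ξ (S i).1)
        (inner ℝ w (ψ (S i).1))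
      have hai : a i = (u (inner ℝ v (ψ (S i).1) + ξ (S i).1) : ℝ) -
        u (inner ℝ w (ψ (S i).1)) := by simp only [ha, hc]
      rw [← hai] at h1
      have h2 : a i * ξ (S i).1 ≤ 1 / 8 / L * a i ^ 2 + 2 * L * ξ (S i).1 ^ 2 := by
        have : 0 ≤ 1 / 8 / L * (a i - 4 * L * ξ (S i).1) ^ 2 := by positivity
        have h3 : 1 / 8 / L * (a i - 4 * L * ξ (S i).1) ^ 2 =
            1 / 8 / L * a i ^ 2 + 2 * L * ξ (S i).1 ^ 2 - a i * ξ (S i).1 := by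
          field_simp; ring
        linarith
      have h4 : a i ^ 2 / L = 7 / 8 / L * a i ^ 2 + 1 / 8 / L * a i ^ 2 := by
        field_simp; ring
      rw [inner_sub_left]
      nlinarith
    calc inner ℝ (w - v) M = ∑ i, a i * inner ℝ (w - v) (ψ (S i).1) := by
          rw [hM, inner_sum]
          exact Finset.sum_congr rfl fun i _ => by rw [inner_smul_right]
      _ ≤ ∑ i, (-(7 / 8 / L) * a i ^ 2 + 2 * L * ξ (S i).1 ^ 2) :=
          Finset.sum_le_sum fun i _ => hterm i
      _ = -(7 / 8 / L) * (m * e) + 2 * L * ∑ i, ξ (S i).1 ^ 2 := by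
          rw [Finset.sum_add_distrib, ← Finset.mul_sum, ← Finset.mul_sum, hsum]
      _ ≤ -(7 / 8 / L) * (m * e) + 2 * L * (m * ρ) := by gcongr
      _ = _ := by ring
  have hMnorm : ‖M‖ ^ 2 ≤ m ^ 2 * e := by
    have := norm_sum_smul_sq_le (a := a) fun i => hψ1 (S i).1
    rw [hsum] at this
    linarith
  have hNM : ‖N + M‖ ^ 2 ≤ m ^ 2 * (5 / 4 * e + 5 * η ^ 2) := by
    have h1 : ‖N + M‖ ^ 2 ≤ (‖N‖ + ‖M‖) ^ 2 := by gcongr; exact norm_add_le _ _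
    have h2 : ‖N‖ ^ 2 ≤ (m * η) ^ 2 := by gcongr
    nlinarith [sq_nonneg (2 * ‖N‖ - ‖M‖ / 2)]
  rw [hstep, norm_add_sq_real, inner_smul_right, inner_add_right, norm_smul, mul_pow,
    Real.norm_of_nonneg (by positivity)]
  have k1 : 1 / L / m * (inner ℝ (w - v) N + inner ℝ (w - v) M) ≤
      1 / L / m * (m * (B * η) + m * (-(7 / 8 * e / L) + 2 * L * ρ)) := by gcongr
  have k2 : (1 / L / m) ^ 2 * ‖N + M‖ ^ 2 ≤
      (1 / L / m) ^ 2 * (m ^ 2 * (5 / 4 * e + 5 * η ^ 2)) := by gcongr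
  have k3 : ‖w - v‖ ^ 2 + 2 * (1 / L / m * (m * (B * η) + m * (-(7 / 8 * e / L) + 2 * L * ρ))) +
      (1 / L / m) ^ 2 * (m ^ 2 * (5 / 4 * e + 5 * η ^ 2)) = ‖w - v‖ ^ 2 -
        (e / (2 * L ^ 2) - 4 * ρ - 2 * η * B / L - 5 * η ^ 2 / L ^ 2) := by
    field_simp
    ring
  linarith

/-- One of the first `T` iterates stays near the target and has a small empirical risk. -/
lemma exists_iterate_empirical_risk_le (hL : 0 < L) (hu : LipschitzWith L.toNNReal u)
    (hmono : Monotone u) (hψ1 : ∀ x, ‖ψ x‖ ≤ 1)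
    (hc : c = fun x => u (inner ℝ v (ψ x) + ξ x)) (hm : 0 < m)
    (hη : ‖∑ i, (((S i).2 : ℝ) - c (S i).1) • ψ (S i).1‖ ≤ m * η)
    (hρ : ∑ i, ξ (S i).1 ^ 2 ≤ m * ρ) (hv : ‖v‖ ≤ B) {T : ℕ} (hT : 0 < T) {g : ℝ} (hg : 0 ≤ g)
    (hTg : B ^ 2 ≤ T * g) :
    ∃ t < T, ‖weightVector ψ u (1 / L) S t - v‖ ≤ B ∧
      (∑ i, predictorLoss u ψ c (weightVector ψ u (1 / L) S t) (S i).1) / m ≤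
        2 * L ^ 2 * (4 * ρ + 2 * η * B / L + 5 * η ^ 2 / L ^ 2 + g) := by
  by_contra! hcon
  have hB0 : 0 ≤ B := (norm_nonneg _).trans hv
  have hstep : ∀ t < T, ‖weightVector ψ u (1 / L) S t - v‖ ≤ B →
      ‖weightVector ψ u (1 / L) S (t + 1) - v‖ ^ 2 + g <
        ‖weightVector ψ u (1 / L) S t - v‖ ^ 2 := fun t ht htB => by
    have h1 := norm_sub_sq_step_le hL hu hmono hψ1 hc hm hη hρ t htB
    have h2 := hcon t ht htB
    rw [← lt_div_iff₀' (by positivity)] at h2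
    linarith
  have hind : ∀ t < T, ‖weightVector ψ u (1 / L) S t - v‖ ^ 2 + t * g ≤ B ^ 2 := fun t => by
    induction t with
    | zero =>
      intro _
      simp only [weightVector, zero_sub, norm_neg, Nat.cast_zero, zero_mul, add_zero]
      gcongr
    | succ t ih =>
      intro ht
      have h1 := ih (by omega)
      have h2 : ‖weightVector ψ u (1 / L) S t - v‖ ≤ B :=
        le_of_sq_le_sq (by nlinarith [mul_nonneg (Nat.cast_nonneg (α := ℝ) t) hg]) hB0
      have h3 := hstep t (by omega) h2
      push_cast
      linarith
  -- The induction stops one step early: the strict decrease of the last step is what contradicts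
  -- `B² ≤ T g` in the case of equality.
  obtain ⟨T, rfl⟩ : ∃ k, T = k + 1 := ⟨T - 1, by omega⟩
  have h1 := hind T (by omega)
  have h2 : ‖weightVector ψ u (1 / L) S T - v‖ ≤ B :=
    le_of_sq_le_sq (by nlinarith [mul_nonneg (Nat.cast_nonneg (α := ℝ) T) hg]) hB0
  have h3 := hstep T (by omega) h2
  push_cast at hTg
  nlinarith [sq_nonneg ‖weightVector ψ u (1 / L) S (T + 1) - v‖]

end GradientDescent

/-! ### Existence of a good iterate. -/

section Training

/-- `log (4 / δ)` is at most this multiple of `log (1 / δ)`, when the latter is at least `ℓ₀`. -/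
noncomputable def logConstant (ℓ₀ : ℝ) : ℝ := 1 + 2 / ℓ₀

/-- The factor by which the norm of the noise vector may exceed `√(log (1 / δ) / m)`. -/
noncomputable def noiseConstant (ℓ₀ : ℝ) : ℝ := 3 + logConstant ℓ₀ + 1 / (2 * ℓ₀)

/-- The factor by which the empirical risk of the best iterate may exceed `L √ε`. -/
noncomputable def empiricalRiskConstant (ℓ₀ C : ℝ) : ℝ :=
  8 * (2 + logConstant ℓ₀ / 4) + 2 * noiseConstant ℓ₀ + 5 * noiseConstant ℓ₀ ^ 2 * C + 1 / C

/-- The factor by which the risk of the best iterate may exceed `L √ε`. -/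
noncomputable def riskConstant (ℓ₀ C : ℝ) : ℝ :=
  8 * empiricalRiskConstant ℓ₀ C + 10 + 1 / ℓ₀ + 2 * logConstant ℓ₀ * C

lemma log_four_lt_two : Real.log 4 < 2 := by
  rw [show (4 : ℝ) = 2 ^ 2 by norm_num, Real.log_pow]
  have := Real.log_two_lt_d9
  push_cast
  linarith

/-- Keeping `δ` away from 1 lets `log (1/δ)` absorb the additive `log 4` caused by splitting `δ`
among four events. -/
lemma log_four_div_le {ℓ₀ δ : ℝ} (hℓ₀ : 0 < ℓ₀) (hδ : 0 < δ) (hℓ : ℓ₀ ≤ Real.log (1 / δ)) :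
    Real.log (1 / (δ / 4)) ≤ logConstant ℓ₀ * Real.log (1 / δ) := by
  have h1 : Real.log (1 / (δ / 4)) = Real.log 4 + Real.log (1 / δ) := by
    rw [← Real.log_mul (by norm_num) (by positivity)]
    congr 1
    field_simp
  have h2 : 2 ≤ 2 / ℓ₀ * Real.log (1 / δ) := by
    rw [div_mul_eq_mul_div, le_div_iff₀ hℓ₀]
    linarith
  rw [h1, logConstant]
  linarith [log_four_lt_two]

variable {X E : Type*} [MeasurableSpace X] [NormedAddCommGroup E] [InnerProductSpace ℝ E]
  [FiniteDimensional ℝ E] [MeasurableSpace E] [BorelSpace E]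
  {D : Measure (X × unitInterval)} [IsProbabilityMeasure D] {c : X → unitInterval} {ψ : X → E}
  {m : ℕ} {u : ℝ → unitInterval} {L : ℝ}

set_option maxHeartbeats 1000000 in
/-- Except with probability `3 δ / 4`, one of the first `T` iterates has risk `O(L √ε)`. -/
lemma exists_measurableSet_iterate_risk_le (hL : 0 < L) (hu : LipschitzWith L.toNNReal u)
    (hmono : Monotone u) (hψ : Measurable ψ) (hψ1 : ∀ x, ‖ψ x‖ ≤ 1) {v : E} {ξ : X → ℝ}
    {B ζ ε : ℝ} (hB : 0 < B) (hζ : 0 < ζ) (hv : ‖v‖ ≤ B) (hξ : Measurable ξ)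
    (hξζ : ∀ x, |ξ x| ≤ ζ) (hε0 : 0 < ε) (hε : ∫ p, ξ p.1 ^ 2 ∂D ≤ ε)
    (hcv : c = fun x => u (inner ℝ v (ψ x) + ξ x)) (hc : IsConditionalMean D c)
    {ℓ₀ δ q C : ℝ} (hℓ₀ : 0 < ℓ₀) (hδ : 0 < δ) (hℓ : ℓ₀ ≤ Real.log (1 / δ)) (hm : 0 < m)
    (hq : 0 < q) (hqm : q ^ 2 * m = Real.log (1 / δ)) (hqζ : 4 * ζ ^ 2 * q ≤ ε)
    (hqB : B * q ≤ √ε / 2) (hC : 0 < C) (hqC : q ≤ C * B * L) {T : ℕ} (hT0 : 0 < T)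
    (hT : C * B * L ≤ T * q) (hs1 : L * √ε ≤ 1) :
    ∃ G : Set (Fin m → X × unitInterval), MeasurableSet G ∧
      (Measure.pi fun _ => D) Gᶜ ≤ ENNReal.ofReal (3 * (δ / 4)) ∧
      ∀ S ∈ G, ∃ t < T, ∫ p, predictorLoss u ψ c (weightVector ψ u (1 / L) S t) p.1 ∂D ≤
        riskConstant ℓ₀ C * (L * √ε) := by
  have hm' : (0 : ℝ) < m := Nat.cast_pos.2 hm
  have hδ4 : 0 < δ / 4 := by positivity
  have hlog := log_four_div_le hℓ₀ hδ hℓ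
  set ℓ := Real.log (1 / δ) with hℓdef
  set K := logConstant ℓ₀ with hK
  have hK1 : 1 ≤ K := by rw [hK, logConstant]; linarith [div_pos two_pos hℓ₀]
  set K' := noiseConstant ℓ₀ with hK'
  have hℓ0 : 0 < ℓ := hℓ₀.trans_le hℓ
  set s := L * √ε with hs
  have hs0 : 0 < s := by positivity
  set b := B * L * q with hb
  have hb0 : 0 < b := by positivity
  have hbs : b ≤ s / 2 := by
    have := mul_le_mul_of_nonneg_left hqB hL.le
    rw [hb, hs]
    linarith
  have hq2 : q ^ 2 ≤ C * s / 2 := by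
    calc q ^ 2 = q * q := sq q
      _ ≤ C * B * L * q := by gcongr
      _ = C * b := by rw [hb]; ring
      _ ≤ C * (s / 2) := by gcongr
      _ = _ := by ring
  -- The choice `lam = q` balances `lam * m` against `ℓ / lam`, as `q² m = ℓ`.
  obtain ⟨G₁, hG₁, hG₁δ, hG₁S⟩ := exists_measurableSet_norm_residual_le (m := m) hc hψ hψ1 hq hδ4
  obtain ⟨G₂, hG₂, hG₂δ, hG₂S⟩ :=
    exists_measurableSet_sum_sq_le (D := D) (m := m) hξ hζ hξζ hε hδ4
  -- With `σ² = Bq/L`, the smoothing cost `L²σ²` is `b`, and the entropy cost `B²/(mσ²)` is `b/ℓ`.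
  have hσ2 : √(B * q / L) ^ 2 = B * q / L := Real.sq_sqrt (by positivity)
  obtain ⟨G₃, hG₃, hG₃δ, hG₃S⟩ := exists_measurableSet_risk_le (D := D) (m := m) hL.le hu hψ hψ1
    hc.1 v (σ := √(B * q / L)) (by positivity) hδ4
  refine ⟨G₁ ∩ (G₂ ∩ G₃), hG₁.inter (hG₂.inter hG₃), ?_, ?_⟩
  · rw [Set.compl_inter, Set.compl_inter]
    refine (measure_union_le _ _).trans ((add_le_add_right (measure_union_le _ _) _).trans ?_)
    rw [show 3 * (δ / 4) = δ / 4 + (δ / 4 + δ / 4) by ring,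
      ENNReal.ofReal_add hδ4.le (by positivity), ENNReal.ofReal_add hδ4.le hδ4.le]
    gcongr
  rintro S ⟨hS₁, hS₂, hS₃⟩
  have hη : ‖∑ i, (((S i).2 : ℝ) - c (S i).1) • ψ (S i).1‖ ≤ m * (K' * q) := by
    refine (hG₁S S hS₁).trans ?_
    have h1 : (1 / 2 + Real.log (1 / (δ / 4))) / q ≤ (1 / (2 * ℓ₀) * ℓ + K * ℓ) / q := by
      gcongr
      rw [div_mul_eq_mul_div, one_mul, div_le_div_iff₀ two_pos (by positivity)]
      linarith
    have h2 : (1 / (2 * ℓ₀) * ℓ + K * ℓ) / q = (1 / (2 * ℓ₀) + K) * (q * m) := by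
      rw [← hqm]
      field_simp
    calc _ ≤ 3 * q * m + (1 / (2 * ℓ₀) + K) * (q * m) := by linarith
      _ = _ := by rw [hK', noiseConstant, ← hK]; ring
  have hρ : ∑ i, ξ (S i).1 ^ 2 ≤ m * ((2 + K / 4) * ε) := by
    -- From `4ζ²q ≤ ε`: if `q ≤ 1` then `ζ²q² ≤ ε/4`, so concentration suffices; if `q ≥ 1` then
    -- already `ξ² ≤ ε/4` pointwise.
    rcases le_total q 1 with hq1 | hq1
    · refine (hG₂S S hS₂).trans ?_
      have h1 : ζ ^ 2 * Real.log (1 / (δ / 4)) ≤ ζ ^ 2 * (K * (q ^ 2 * m)) := by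
        rw [hqm]; gcongr
      have h2 : ζ ^ 2 * q ^ 2 ≤ ε / 4 := by nlinarith [mul_nonneg (sq_nonneg ζ) hq.le]
      have h3 : ζ ^ 2 * (K * (q ^ 2 * m)) ≤ K * m * (ε / 4) := by
        calc _ = K * m * (ζ ^ 2 * q ^ 2) := by ring
          _ ≤ _ := by gcongr
      linarith
    · have h1 : ∀ i, ξ (S i).1 ^ 2 ≤ ε / 4 := fun i => by
        have h2 : ξ (S i).1 ^ 2 ≤ ζ ^ 2 := by
          rw [← sq_abs]; gcongr; exact hξζ _
        nlinarith [sq_nonneg ζ]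
      calc ∑ i, ξ (S i).1 ^ 2 ≤ ∑ _i : Fin m, ε / 4 := Finset.sum_le_sum fun i _ => h1 i
        _ = m * (ε / 4) := by simp
        _ ≤ _ := by gcongr; nlinarith
  -- This `g` is the decrease per step that `T ≥ CBL/q` steps need to exhaust `B²`.
  obtain ⟨t, ht, htB, hte⟩ := exists_iterate_empirical_risk_le hL hu hmono hψ1 hcv hm hη hρ hv hT0
    (g := B * q / (C * L)) (by positivity) (by
      rw [← mul_div_assoc, le_div_iff₀ (by positivity)]
      nlinarith [mul_le_mul_of_nonneg_left hT hB.le])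
  refine ⟨t, ht, ?_⟩
  set w := weightVector ψ u (1 / L) S t with hw
  set e := (∑ i, predictorLoss u ψ c w (S i).1) / m with he
  have hLε : L ^ 2 * ε ≤ s := by
    have : L ^ 2 * ε = s * s := by
      rw [hs, mul_mul_mul_comm, Real.mul_self_sqrt hε0.le]; ring
    rw [this]
    nlinarith
  have hK'0 : 0 < K' := by rw [hK', noiseConstant, ← hK]; positivity
  have he1 : e ≤ empiricalRiskConstant ℓ₀ C * s := by
    refine hte.trans ?_
    have h1 : 2 * L ^ 2 * (4 * ((2 + K / 4) * ε) + 2 * (K' * q) * B / L +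
        5 * (K' * q) ^ 2 / L ^ 2 + B * q / (C * L)) =
        8 * (2 + K / 4) * (L ^ 2 * ε) + 4 * K' * b + 10 * K' ^ 2 * q ^ 2 + 2 / C * b := by
      rw [hb]
      field_simp
      ring
    rw [h1]
    calc _ ≤ 8 * (2 + K / 4) * s + 4 * K' * (s / 2) + 10 * K' ^ 2 * (C * s / 2) +
          2 / C * (s / 2) := by gcongr
      _ = _ := by rw [empiricalRiskConstant, ← hK, ← hK']; ring
  have hrisk := hG₃S S hS₃ w
  rw [hσ2] at hrisk
  have hsum : ∑ i, predictorLoss u ψ c w (S i).1 = m * e := by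
    rw [he, mul_div_cancel₀ _ hm'.ne']
  rw [hsum] at hrisk
  have h1 : 2 * ‖w - v‖ ^ 2 / (B * q / L) ≤ m * (2 * b / ℓ₀) := by
    calc 2 * ‖w - v‖ ^ 2 / (B * q / L) ≤ 2 * B ^ 2 / (B * q / L) := by gcongr
      _ = 2 * b * (m / ℓ) := by
        rw [← hqm, hb]
        field_simp
      _ ≤ 2 * b * (m / ℓ₀) := by gcongr
      _ = _ := by ring
  have h2 : 20 * m * L ^ 2 * (B * q / L) = m * (20 * b) := by
    rw [hb]; field_simp
  have h3 : 4 * Real.log (1 / (δ / 4)) ≤ m * (4 * K * q ^ 2) := by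
    rw [← hqm] at hlog
    linarith
  have h4 : m * ∫ p, predictorLoss u ψ c w p.1 ∂D ≤
      m * (8 * e + 20 * b + 2 * b / ℓ₀ + 4 * K * q ^ 2) := by linarith
  refine (le_of_mul_le_mul_left h4 hm').trans ?_
  calc 8 * e + 20 * b + 2 * b / ℓ₀ + 4 * K * q ^ 2
      ≤ 8 * (empiricalRiskConstant ℓ₀ C * s) + 20 * (s / 2) + 2 * (s / 2) / ℓ₀ +
        4 * K * (C * s / 2) := by gcongr
    _ = _ := by rw [riskConstant, ← hK]; ring

end Training

/-! ### Selection on independent validation data. -/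

section Selection

variable {X : Type*} [MeasurableSpace X] {D : Measure (X × unitInterval)} [IsProbabilityMeasure D]
  {c : X → unitInterval} {m : ℕ}

/-- Among `T` hypotheses that depend on independent data, one of minimal validation error has an
error within a constant factor of the best, up to an additive term `r`. -/
lemma measure_validation_selection_le {Ω : Type*} [MeasurableSpace Ω] (P : Measure Ω)
    [IsProbabilityMeasure P] (hc : IsConditionalMean D c) {H : ℕ → Ω → X → unitInterval}
    (hH : ∀ t, Measurable (Function.uncurry (H t))) {T : ℕ} {r : ℝ} :
    ∃ A : Set (Ω × (Fin m → X × unitInterval)), MeasurableSet A ∧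
      P.prod (Measure.pi fun _ => D) A ≤ ENNReal.ofReal (T ^ 2 * Real.exp (-(m * (r / 32)))) ∧
      ∀ q ∉ A, ∀ t < T, ∀ s < T,
        ∑ j, ((H t q.1 (q.2 j).1 : ℝ) - (q.2 j).2) ^ 2 ≤
          ∑ j, ((H s q.1 (q.2 j).1 : ℝ) - (q.2 j).2) ^ 2 →
        generalizationError D c (H t q.1) ≤ 3 * generalizationError D c (H s q.1) + r := by
  have hcm := hc.1
  have hHx : ∀ t ω, Measurable (H t ω) := fun t ω => (hH t).comp measurable_prodMk_left
  have herr : ∀ t, Measurable fun ω => generalizationError D c (H t ω) := fun t => by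
    have h1 : Measurable (Function.uncurry fun (ω : Ω) (p : X × unitInterval) =>
        ((H t ω p.1 : ℝ) - c p.1) ^ 2) := by
      have := (hH t).comp (f := fun q : Ω × X × unitInterval => (q.1, q.2.1)) (by fun_prop)
      exact ((measurable_subtype_coe.comp this).sub (by fun_prop)).pow_const 2
    exact h1.stronglyMeasurable.integral_prod_right.measurable
  have hval : ∀ t, Measurable fun q : Ω × (Fin m → X × unitInterval) =>
      ∑ j, ((H t q.1 (q.2 j).1 : ℝ) - (q.2 j).2) ^ 2 := fun t => by
    refine Finset.measurable_fun_sum _ fun j _ => ?_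
    have := (hH t).comp (f := fun q : Ω × (Fin m → X × unitInterval) => (q.1, (q.2 j).1))
      (by fun_prop)
    exact ((measurable_subtype_coe.comp this).sub (by fun_prop)).pow_const 2
  set A : ℕ → ℕ → Set (Ω × (Fin m → X × unitInterval)) := fun t s =>
    {q | ∑ j, ((H t q.1 (q.2 j).1 : ℝ) - (q.2 j).2) ^ 2 ≤
      ∑ j, ((H s q.1 (q.2 j).1 : ℝ) - (q.2 j).2) ^ 2} ∩
    {q | 3 * generalizationError D c (H s q.1) + r < generalizationError D c (H t q.1)} with hA
  have hAm : ∀ t s, MeasurableSet (A t s) := fun t s =>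
    (measurableSet_le (hval t) (hval s)).inter (measurableSet_lt
      ((((herr s).comp measurable_fst).const_mul 3).add_const r) ((herr t).comp measurable_fst))
  have hAP : ∀ t s, P.prod (Measure.pi fun _ => D) (A t s) ≤
      ENNReal.ofReal (Real.exp (-(m * (r / 32)))) := fun t s => by
    -- For fixed training data the two hypotheses are fixed, so the two-hypothesis bound applies on
    -- each fibre; fibres without the gap are empty.
    rw [Measure.prod_apply (hAm t s)]
    calc _ ≤ ∫⁻ _, ENNReal.ofReal (Real.exp (-(m * (r / 32)))) ∂P := by
          refine lintegral_mono fun ω => ?_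
          by_cases hω : 3 * generalizationError D c (H s ω) + r < generalizationError D c (H t ω)
          · refine (measure_mono fun V hV => ?_).trans ((measure_validation_le_le hc
              (hHx t ω) (hHx s ω)).trans (ENNReal.ofReal_le_ofReal (Real.exp_le_exp.2
                (neg_le_neg ?_))))
            · exact hV.1
            · gcongr
              linarith
          · have : Prod.mk ω ⁻¹' A t s = ∅ := by
              ext V
              simp only [hA, Set.mem_preimage, Set.mem_inter_iff, Set.mem_ofPred_eq,
                Set.mem_empty_iff_false, iff_false, not_and]
              exact fun _ => hω
            simp [this]
      _ = _ := by simp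
  refine ⟨⋃ t ∈ Finset.range T, ⋃ s ∈ Finset.range T, A t s,
    Finset.measurableSet_biUnion _ fun t _ => Finset.measurableSet_biUnion _ fun s _ => hAm t s,
    ?_, fun q hq t ht s hs hle => ?_⟩
  · calc _ ≤ ∑ t ∈ Finset.range T, ∑ s ∈ Finset.range T,
          P.prod (Measure.pi fun _ => D) (A t s) :=
        (measure_biUnion_finset_le _ _).trans
          (Finset.sum_le_sum fun t _ => measure_biUnion_finset_le _ _)
      _ ≤ ∑ t ∈ Finset.range T, ∑ s ∈ Finset.range T,
          ENNReal.ofReal (Real.exp (-(m * (r / 32)))) := by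
        gcongr with t _ s _
        exact hAP t s
      _ = _ := by
        simp only [Finset.sum_const, Finset.card_range, nsmul_eq_mul]
        rw [ENNReal.ofReal_mul (by positivity), sq, ENNReal.ofReal_mul (by positivity),
          ENNReal.ofReal_natCast, mul_assoc]
  · by_contra! hcon
    refine hq (Set.mem_biUnion (Finset.mem_coe.2 (Finset.mem_range.2 ht)) ?_)
    exact Set.mem_biUnion (Finset.mem_coe.2 (Finset.mem_range.2 hs)) ⟨hle, hcon⟩

/-- Splitting an i.i.d. sample into its first `m₁` and its last `m₂` elements. -/
lemma pi_append_preimage {Z : Type*} [MeasurableSpace Z] (D : Measure Z) [IsProbabilityMeasure D]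
    (m₁ m₂ : ℕ) {A : Set ((Fin m₁ → Z) × (Fin m₂ → Z))} (hA : MeasurableSet A) :
    (Measure.pi fun _ : Fin (m₁ + m₂) => D)
      ((fun S => (fun i => S (Fin.castAdd m₂ i), fun j => S (Fin.natAdd m₁ j))) ⁻¹' A) =
    ((Measure.pi fun _ => D).prod (Measure.pi fun _ => D)) A := by
  have happ : Measurable fun q : (Fin m₁ → Z) × (Fin m₂ → Z) => Fin.append q.1 q.2 := by
    refine measurable_pi_lambda _ fun k => ?_
    refine Fin.addCases (fun i => ?_) (fun j => ?_) k
    · simp only [Fin.append_left]; fun_prop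
    · simp only [Fin.append_right]; fun_prop
  have hpi : (Measure.pi fun _ : Fin (m₁ + m₂) => D) =
      ((Measure.pi fun _ : Fin m₁ => D).prod (Measure.pi fun _ : Fin m₂ => D)).map
        fun q => Fin.append q.1 q.2 := by
    refine Measure.pi_eq fun s hs => ?_
    rw [Measure.map_apply happ (MeasurableSet.univ_pi hs)]
    have : (fun q : (Fin m₁ → Z) × (Fin m₂ → Z) => Fin.append q.1 q.2) ⁻¹' Set.univ.pi s =
        (Set.univ.pi fun i => s (Fin.castAdd m₂ i)) ×ˢ
          (Set.univ.pi fun j => s (Fin.natAdd m₁ j)) := by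
      ext q
      simp only [Set.mem_preimage, Set.mem_pi, Set.mem_univ, true_imp_iff, Set.mem_prod,
        Fin.forall_fin_add, Fin.append_left, Fin.append_right]
    rw [this, Measure.prod_prod, Measure.pi_pi, Measure.pi_pi, Fin.prod_univ_add]
  rw [hpi, Measure.map_apply happ (by measurability)]
  congr 1
  ext q
  simp only [Set.mem_preimage, Fin.append_left, Fin.append_right]

end Selection

/-! ### Feature map and kernel trick. -/

section FeatureMap

variable {n d : ℕ}

/-- The squared monomials of degree `i` sum to `‖x‖ ^ (2 i) ≤ 1`, and the normalization averages
over the `d + 1` degrees. -/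
lemma norm_featureMap_le_one (x : UnitBall n) : ‖featureMap n d x‖ ≤ 1 := by
  have hx : ∑ l, x.1 l ^ 2 ≤ 1 := by
    have h := pow_le_one₀ (n := 2) (norm_nonneg _) (mem_closedBall_zero_iff.1 x.2)
    rw [EuclideanSpace.norm_sq_eq] at h
    simpa using h
  rw [EuclideanSpace.norm_eq]
  refine Real.sqrt_le_one.2 ?_
  have h1 : ∀ k : Σ i : Fin (d + 1), (Fin (i : ℕ) → Fin n), ‖featureMap n d x k‖ ^ 2 =
      1 / ((d : ℝ) + 1) * ∏ j, x.1 (k.2 j) ^ 2 := fun k => by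
    rw [Real.norm_eq_abs, sq_abs, featureMap]
    simp only [mul_pow, div_pow, one_pow, Finset.prod_pow]
    rw [Real.sq_sqrt (by positivity)]
  simp only [h1]
  rw [Fintype.sum_sigma]
  simp only [← Finset.mul_sum]
  have h2 : ∀ i : Fin (d + 1), ∑ f : Fin (i : ℕ) → Fin n, ∏ j, x.1 (f j) ^ 2 ≤ 1 := fun i => by
    have h := Finset.prod_univ_sum (fun _ : Fin (i : ℕ) => (Finset.univ : Finset (Fin n)))
      (fun _ l => x.1 l ^ 2)
    rw [Fintype.piFinset_univ] at h
    rw [← h, Finset.prod_const]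
    exact pow_le_one₀ (Finset.sum_nonneg fun l _ => sq_nonneg _) hx
  calc 1 / ((d : ℝ) + 1) * ∑ i : Fin (d + 1), ∑ f : Fin (i : ℕ) → Fin n, ∏ j, x.1 (f j) ^ 2
      ≤ 1 / ((d : ℝ) + 1) * ∑ _i : Fin (d + 1), 1 := by
        gcongr with i
        exact h2 i
    _ = 1 := by
        simp only [Finset.sum_const, Finset.card_univ, Fintype.card_fin, nsmul_eq_mul, mul_one]
        push_cast
        field_simp

lemma continuous_featureMap : Continuous (featureMap n d) := by
  unfold featureMap
  fun_prop

/-- Kernel trick: the coefficients `αᵗ` represent the vector `∑ᵢ αᵢᵗ ψ(xᵢ)`, which obeys the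
recursion of `weightVector`. -/
lemma alphatronHypothesis_weights_eq {m : ℕ} (u : ℝ → unitInterval) (lam : ℝ)
    (S : Fin m → UnitBall n × unitInterval) (t : ℕ) :
    alphatronHypothesis d u S (alphatronWeights d u lam S t) =
      fun x => u (inner ℝ (weightVector (featureMap n d) u lam S t) (featureMap n d x)) := by
  have key : ∀ α : Fin m → ℝ, alphatronHypothesis d u S α = fun x =>
      u (inner ℝ (∑ i, α i • featureMap n d (S i).1) (featureMap n d x)) := fun α => by
    funext x
    simp only [alphatronHypothesis, multinomialKernel, sum_inner, inner_smul_left, conj_trivial,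
      real_inner_comm]
  have hw : ∑ i, alphatronWeights d u lam S t i • featureMap n d (S i).1 =
      weightVector (featureMap n d) u lam S t := by
    induction t with
    | zero => simp [alphatronWeights, weightVector]
    | succ t ih =>
      simp only [alphatronWeights, weightVector, add_smul, Finset.sum_add_distrib]
      rw [ih, key, ih, Finset.smul_sum]
      simp only [mul_smul]
  rw [key, hw]

end FeatureMap

/-! ### Measurability and minimality of the output. -/

section Output

variable {X E : Type*} [MeasurableSpace X] [NormedAddCommGroup E] [InnerProductSpace ℝ E]
  [FiniteDimensional ℝ E] [MeasurableSpace E] [BorelSpace E] {ψ : X → E} {m : ℕ}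
  {u : ℝ → unitInterval}

lemma measurable_weightVector (hu : Measurable u) (hψ : Measurable ψ) (lam : ℝ) (t : ℕ) :
    Measurable fun S : Fin m → X × unitInterval => weightVector ψ u lam S t := by
  induction t with
  | zero => exact measurable_const
  | succ t ih =>
    simp only [weightVector]
    fun_prop

lemma measurable_weightVector_predictor (hu : Measurable u) (hψ : Measurable ψ) (lam : ℝ) (t : ℕ) :
    Measurable (Function.uncurry fun (S : Fin m → X × unitInterval) (x : X) =>
      u (inner ℝ (weightVector ψ u lam S t) (ψ x))) := by
  have h := measurable_weightVector (m := m) hu hψ lam t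
  exact hu.comp ((h.comp measurable_fst).inner (hψ.comp measurable_snd))

/-- Positivity of `T` makes the set of minimizers nonempty; for `T = 0` the `sInf` would be the
default 0. -/
lemma alphatronOutputIndex_spec {n m₁ m₂ : ℕ} (d : ℕ) (u : ℝ → unitInterval) (lam : ℝ) {T : ℕ}
    (hT : 0 < T) (S : Fin m₁ → UnitBall n × unitInterval)
    (V : Fin m₂ → UnitBall n × unitInterval) :
    alphatronOutputIndex d u lam T S V < T ∧ ∀ s < T,
      validationError V (alphatronHypothesis d u S (alphatronWeights d u lam S
        (alphatronOutputIndex d u lam T S V))) ≤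
      validationError V (alphatronHypothesis d u S (alphatronWeights d u lam S s)) := by
  refine Nat.sInf_mem (s := {t | t < T ∧ ∀ s < T,
    validationError V (alphatronHypothesis d u S (alphatronWeights d u lam S t)) ≤
      validationError V (alphatronHypothesis d u S (alphatronWeights d u lam S s))}) ?_
  obtain ⟨t, ht, hmin⟩ := Finset.exists_min_image (Finset.range T)
    (fun t => validationError V (alphatronHypothesis d u S (alphatronWeights d u lam S t)))
    ⟨0, Finset.mem_range.2 hT⟩
  exact ⟨t, Finset.mem_range.1 ht, fun s hs => hmin s (Finset.mem_range.2 hs)⟩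

end Output

/-! ### The guarantee at fixed confidence. -/

section Learnability

/-- The additive loss of the validation step is at most this constant over `m`. -/
noncomputable def validationConstant (ℓ₀ C' : ℝ) : ℝ := 64 * (1 + 1 / ℓ₀) / C'

/-- The constant in the error bound of the Alphatron. -/
noncomputable def alphatronConstant (ℓ₀ C C' : ℝ) : ℝ :=
  3 * riskConstant ℓ₀ C + validationConstant ℓ₀ C' * C / (2 * ℓ₀) + 1 / C + 2

lemma alphatronConstant_pos_terms {ℓ₀ C C' : ℝ} (hℓ₀ : 0 < ℓ₀) (hC : 0 < C) (hC' : 0 < C') :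
    0 < riskConstant ℓ₀ C ∧ 0 < validationConstant ℓ₀ C' * C / (2 * ℓ₀) := by
  constructor
  · unfold riskConstant empiricalRiskConstant noiseConstant logConstant
    positivity
  · unfold validationConstant
    positivity

lemma generalizationError_le_one {X : Type*} [MeasurableSpace X]
    {D : Measure (X × unitInterval)} [IsProbabilityMeasure D] {c h : X → unitInterval}
    (hh : Measurable h) (hc : Measurable c) : generalizationError D c h ≤ 1 := by
  calc generalizationError D c h ≤ ∫ _, (1 : ℝ) ∂D :=
        integral_mono (integrable_sq_coe_sub_coe hh hc) (integrable_const _)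
          fun p => (sq_le_one_iff_abs_le_one _).2 (abs_coe_sub_coe_le_one _ _)
    _ = 1 := by simp

/-- The risk of the initial hypothesis. -/
lemma generalizationError_const_le {X E : Type*} [MeasurableSpace X] [NormedAddCommGroup E]
    [InnerProductSpace ℝ E] {D : Measure (X × unitInterval)} [IsProbabilityMeasure D]
    {c : X → unitInterval} {ψ : X → E} {u : ℝ → unitInterval} {L B ε ζ : ℝ} {v : E} {ξ : X → ℝ}
    (hL : 0 ≤ L) (hu : LipschitzWith L.toNNReal u) (hψ1 : ∀ x, ‖ψ x‖ ≤ 1) (hv : ‖v‖ ≤ B)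
    (hξ : Measurable ξ) (hξζ : ∀ x, |ξ x| ≤ ζ) (hε : ∫ p, ξ p.1 ^ 2 ∂D ≤ ε)
    (hcv : c = fun x => u (inner ℝ v (ψ x) + ξ x)) (hc : Measurable c) :
    generalizationError D c (fun _ => u 0) ≤ 2 * L ^ 2 * B ^ 2 + 2 * L ^ 2 * ε := by
  have hi : Integrable (fun p : X × unitInterval => ξ p.1 ^ 2) D :=
    Integrable.of_bound (C := ζ ^ 2)
      ((hξ.comp measurable_fst).pow_const 2).aestronglyMeasurable (.of_forall fun p => by
      rw [Real.norm_of_nonneg (sq_nonneg _)]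
      exact sq_le_sq' (abs_le.1 (hξζ _)).1 (abs_le.1 (hξζ _)).2)
  calc generalizationError D c (fun _ => u 0)
      ≤ ∫ p, (2 * L ^ 2 * B ^ 2 + 2 * L ^ 2 * ξ p.1 ^ 2) ∂D := by
        refine integral_mono (integrable_sq_coe_sub_coe measurable_const hc)
          ((integrable_const _).add (hi.const_mul _)) fun p => ?_
        have h1 := abs_coe_sub_le_of_lipschitz hL hu 0 (inner ℝ v (ψ p.1) + ξ p.1)
        have h2 : (inner ℝ v (ψ p.1) : ℝ) ^ 2 ≤ B ^ 2 := by
          rw [← sq_abs]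
          gcongr
          calc |(inner ℝ v (ψ p.1) : ℝ)| ≤ ‖v‖ * ‖ψ p.1‖ := abs_real_inner_le_norm _ _
            _ ≤ B := (mul_le_of_le_one_right (norm_nonneg _) (hψ1 _)).trans hv
        have h3 : ((u 0 : ℝ) - c p.1) ^ 2 ≤ L ^ 2 * (inner ℝ v (ψ p.1) + ξ p.1) ^ 2 := by
          rw [hcv, ← sq_abs, ← sq_abs (inner ℝ v (ψ p.1) + ξ p.1), ← mul_pow]
          rw [zero_sub, abs_neg] at h1
          gcongr
        have h4 : (inner ℝ v (ψ p.1) + ξ p.1) ^ 2 ≤ 2 * B ^ 2 + 2 * ξ p.1 ^ 2 := by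
          nlinarith [sq_nonneg ((inner ℝ v (ψ p.1) : ℝ) - ξ p.1)]
        calc _ ≤ L ^ 2 * (inner ℝ v (ψ p.1) + ξ p.1) ^ 2 := h3
          _ ≤ L ^ 2 * (2 * B ^ 2 + 2 * ξ p.1 ^ 2) := by gcongr
          _ = _ := by ring
    _ = 2 * L ^ 2 * B ^ 2 + 2 * L ^ 2 * ∫ p, ξ p.1 ^ 2 ∂D := by
        rw [integral_add (integrable_const _) (hi.const_mul _), integral_const]
        simp only [probReal_univ, smul_eq_mul, one_mul]
        rw [integral_const_mul]
    _ ≤ _ := by gcongr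

/-- Pays for the union bound over `T²` pairs: `log (4T²/δ) ≤ (2 + 2/ℓ₀) log (T/δ)`, and
`validationConstant` is 32 times this factor over `C'`. -/
lemma sq_mul_exp_validationSize_le {ℓ₀ δ C' : ℝ} {m T : ℕ} (hℓ₀ : 0 < ℓ₀) (hδ : 0 < δ)
    (hℓ : ℓ₀ ≤ Real.log (1 / δ)) (hC' : 0 < C') (hm : 0 < m) (hT : 0 < T) :
    (T : ℝ) ^ 2 * Real.exp (-(alphatronValidationSize C' δ m T *
      (validationConstant ℓ₀ C' / m / 32))) ≤ δ / 4 := by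
  have hm' : (0 : ℝ) < m := Nat.cast_pos.2 hm
  have hT' : (1 : ℝ) ≤ T := by exact_mod_cast hT
  have hlogT : 0 ≤ Real.log T := Real.log_nonneg hT'
  have hlog : Real.log (T / δ) = Real.log T + Real.log (1 / δ) := by
    rw [← Real.log_mul (by positivity) (by positivity), mul_one_div]
  have h1 : C' * m * Real.log (T / δ) ≤ alphatronValidationSize C' δ m T := Nat.le_ceil _
  have h2 : Real.log (4 * T ^ 2 / δ) ≤
      alphatronValidationSize C' δ m T * (validationConstant ℓ₀ C' / m / 32) := by
    calc Real.log (4 * T ^ 2 / δ) = Real.log 4 + 2 * Real.log T + Real.log (1 / δ) := by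
          rw [mul_div_assoc, Real.log_mul (by norm_num) (by positivity), ← mul_one_div,
            Real.log_mul (by positivity) (by positivity), Real.log_pow]
          push_cast
          ring
      _ ≤ (2 + 2 / ℓ₀) * Real.log (T / δ) := by
          have h3 : 2 ≤ 2 / ℓ₀ * Real.log (T / δ) := by
            rw [div_mul_eq_mul_div, le_div_iff₀ hℓ₀]
            linarith
          linarith [log_four_lt_two]
      _ = C' * m * Real.log (T / δ) * (validationConstant ℓ₀ C' / m / 32) := by
          rw [validationConstant]
          field_simp
          ring
      _ ≤ _ := by
          have : 0 ≤ validationConstant ℓ₀ C' / m / 32 := by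
            rw [validationConstant]; positivity
          gcongr
  calc _ ≤ (T : ℝ) ^ 2 * Real.exp (-Real.log (4 * T ^ 2 / δ)) := by gcongr
    _ = δ / 4 := by
      rw [Real.exp_neg, Real.exp_log (by positivity)]
      field_simp

lemma measurable_alphatron {n m₁ m₂ : ℕ} (d : ℕ) {u : ℝ → unitInterval} (hu : Continuous u)
    (lam : ℝ) (T : ℕ) (S : Fin m₁ → UnitBall n × unitInterval)
    (V : Fin m₂ → UnitBall n × unitInterval) : Measurable (alphatron d u lam T S V) := by
  have hum := hu.measurable
  have hψ := (continuous_featureMap (n := n) (d := d)).measurable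
  rw [alphatron, alphatronHypothesis_weights_eq]
  fun_prop

/-- The guarantee of the Alphatron at a fixed confidence parameter. -/
lemma exists_measurableSet_alphatron_error_le {n d : ℕ} {B L ζ ε : ℝ} (hB : 0 < B) (hL : 0 < L) (hζ : 0 < ζ)
    (hε : 0 < ε) {u : ℝ → unitInterval} (hu : LipschitzWith L.toNNReal u) (hmono : Monotone u)
    {D : Measure (UnitBall n × unitInterval)} [IsProbabilityMeasure D]
    {c : UnitBall n → unitInterval} (hDc : (D, c) ∈ alphatronClass n d B ζ ε u)
    (hc : IsConditionalMean D c) {ℓ₀ C C' δ : ℝ} (hℓ₀ : 0 < ℓ₀) (hC : 0 < C) (hC' : 0 < C')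
    (hδ : 0 < δ) (hℓ : ℓ₀ ≤ Real.log (1 / δ)) {m : ℕ}
    (hmζ : 16 * ζ ^ 4 / ε ^ 2 * Real.log (1 / δ) ≤ m)
    (hmB : 4 * B ^ 2 / ε * Real.log (1 / δ) ≤ m) {T m₂ : ℕ}
    (hT : T = alphatronIterations C B L δ m) (hm₂ : m₂ = alphatronValidationSize C' δ m T) :
    ∃ F : Set ((Fin m → UnitBall n × unitInterval) × (Fin m₂ → UnitBall n × unitInterval)),
      MeasurableSet F ∧
      ((Measure.pi fun _ => D).prod (Measure.pi fun _ => D)) F ≤ ENNReal.ofReal δ ∧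
      ∀ S V, (S, V) ∉ F → generalizationError D c (alphatron d u (1 / L) T S V) ≤
        alphatronConstant ℓ₀ C C' * (L * √ε) := by
  obtain ⟨v, ξ, hv, hξ, hξζ, hξε, hcv⟩ := hDc
  replace hcv : c = fun x => u (inner ℝ v (featureMap n d x) + ξ x) := hcv
  replace hξζ : ∀ x, |ξ x| ≤ ζ := fun x => abs_le.2 (hξζ x)
  have hψ : Measurable (featureMap n d) := continuous_featureMap.measurable
  have hψ1 : ∀ x, ‖featureMap n d x‖ ≤ 1 := fun x => norm_featureMap_le_one x
  have hum : Measurable u := hu.continuous.measurable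
  set H : ℕ → (Fin m → UnitBall n × unitInterval) → UnitBall n → unitInterval := fun t S x =>
    u (inner ℝ (weightVector (featureMap n d) u (1 / L) S t) (featureMap n d x)) with hH
  have hHm : ∀ t, Measurable (Function.uncurry (H t)) := fun t =>
    measurable_weightVector_predictor hum hψ (1 / L) t
  have hHeq : ∀ t S, alphatronHypothesis d u S (alphatronWeights d u (1 / L) S t) = H t S :=
    fun t S => alphatronHypothesis_weights_eq u (1 / L) S t
  have hmeas := fun S V => measurable_alphatron (m₁ := m) (m₂ := m₂) (n := n) d hu.continuous
    (1 / L) T S V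
  obtain ⟨hR0, hV0⟩ := alphatronConstant_pos_terms hℓ₀ hC hC'
  have hC0 : 0 < 1 / C := by positivity
  set s := L * √ε with hs
  have hs0 : 0 < s := by positivity
  have hs2 : L ^ 2 * ε = s * s := by
    rw [hs, mul_mul_mul_comm, Real.mul_self_sqrt hε.le]; ring
  rcases le_total 1 s with hs1 | hs1
  · refine ⟨∅, .empty, by simp, fun S V _ => (generalizationError_le_one (hmeas S V) hc.1).trans ?_⟩
    rw [alphatronConstant]
    nlinarith
  set ℓ := Real.log (1 / δ) with hℓdef
  have hℓ0 : 0 < ℓ := hℓ₀.trans_le hℓ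
  have hm' : (0 : ℝ) < m := lt_of_lt_of_le (by positivity) hmB
  have hm : 0 < m := Nat.cast_pos.1 hm'
  set q := √(ℓ / m) with hq
  have hq0 : 0 < q := by positivity
  have hq2 : q ^ 2 = ℓ / m := Real.sq_sqrt (by positivity)
  have hqm : q ^ 2 * m = ℓ := by rw [hq2]; field_simp
  -- This and the next inequality are the square roots of the two lower bounds on the training set
  -- size.
  have hqζ : 4 * ζ ^ 2 * q ≤ ε := by
    refine le_of_sq_le_sq ?_ hε.le
    rw [mul_pow, hq2]
    rw [div_mul_eq_mul_div, div_le_iff₀ (by positivity)] at hmζ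
    rw [← mul_div_assoc, div_le_iff₀ hm']
    linarith
  have hqB : B * q ≤ √ε / 2 := by
    refine le_of_sq_le_sq ?_ (by positivity)
    rw [mul_pow, hq2, div_pow, Real.sq_sqrt hε.le]
    rw [div_mul_eq_mul_div, div_le_iff₀ hε] at hmB
    rw [← mul_div_assoc, div_le_div_iff₀ hm' (by norm_num)]
    linarith
  have hb : B * L * q ≤ s / 2 := by
    have := mul_le_mul_of_nonneg_left hqB hL.le
    rw [hs]
    linarith
  have hTeq : T = ⌈C * B * L * √((m : ℝ) / ℓ)⌉₊ := hT
  have hsqrt : √((m : ℝ) / ℓ) = 1 / q := by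
    rw [hq, ← inv_div, Real.sqrt_inv, one_div]
  rw [hsqrt, mul_one_div] at hTeq
  have hT0 : 0 < T := by
    rw [hTeq]
    exact Nat.ceil_pos.2 (by positivity)
  rcases le_total (C * B * L) q with hCq | hqC
  · have hT1 : T ≤ 1 := by
      rw [hTeq]
      refine Nat.ceil_le.2 ?_
      rw [Nat.cast_one, div_le_one hq0]
      exact hCq
    refine ⟨∅, .empty, by simp, fun S V _ => ?_⟩
    have h0 : alphatronOutputIndex d u (1 / L) T S V = 0 := by
      have := (alphatronOutputIndex_spec d u (1 / L) hT0 S V).1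
      omega
    have hout : alphatron d u (1 / L) T S V = fun _ => u 0 := by
      rw [alphatron, h0, hHeq]
      simp only [hH, weightVector, inner_zero_left]
    rw [hout]
    refine (generalizationError_const_le hL.le hu hψ1 hv hξ hξζ hξε hcv hc.1).trans ?_
    have h1 : L ^ 2 * B ^ 2 ≤ s / (2 * C) := by
      rw [le_div_iff₀ (by positivity)]
      have : C * B * L * (B * L) ≤ q * (B * L) := by gcongr
      linarith
    have h2 : s / (2 * C) = 1 / C * s / 2 := by field_simp
    rw [alphatronConstant]
    have h3 : 0 < riskConstant ℓ₀ C * s := by positivity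
    have h4 : 0 < validationConstant ℓ₀ C' * C / (2 * ℓ₀) * s := by positivity
    nlinarith
  obtain ⟨G, hG, hGδ, hGS⟩ := exists_measurableSet_iterate_risk_le hL hu hmono hψ hψ1 hB hζ hv hξ
    hξζ hε hξε hcv hc hℓ₀ hδ hℓ hm hq0 hqm hqζ hqB hC hqC hT0
    (by rw [← div_le_iff₀ hq0, hTeq]; exact Nat.le_ceil _) hs1
  obtain ⟨A, hA, hAδ, hAS⟩ := measure_validation_selection_le (m := m₂)
    (Measure.pi fun _ : Fin m => D) hc hHm (T := T) (r := validationConstant ℓ₀ C' / m)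
  have hexp := sq_mul_exp_validationSize_le hℓ₀ hδ hℓ hC' hm hT0
  rw [← hm₂] at hexp
  have hA' := hAδ.trans (ENNReal.ofReal_le_ofReal hexp)
  -- For `m₂ = 0` all validation errors would be 0; positivity lets the factor `1 / m₂` be
  -- cancelled.
  have hm₂0 : 0 < m₂ := by
    rw [hm₂, alphatronValidationSize]
    refine Nat.ceil_pos.2 (mul_pos (mul_pos hC' hm') (Real.log_pos ?_))
    have h1 : 1 < 1 / δ := (Real.log_pos_iff (by positivity)).1 hℓ0
    have h2 : (1 : ℝ) ≤ T := by exact_mod_cast hT0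
    exact h1.trans_le (by gcongr)
  refine ⟨Gᶜ ×ˢ Set.univ ∪ A, (hG.compl.prod MeasurableSet.univ).union hA, ?_, fun S V hSV => ?_⟩
  · refine (measure_union_le _ _).trans ?_
    rw [Measure.prod_prod, measure_univ, mul_one]
    calc _ ≤ ENNReal.ofReal (3 * (δ / 4)) + ENNReal.ofReal (δ / 4) := add_le_add hGδ hA'
      _ = ENNReal.ofReal δ := by
        rw [← ENNReal.ofReal_add (by positivity) (by positivity)]
        congr 1
        ring
  · simp only [Set.mem_union, Set.mem_prod, Set.mem_compl_iff, Set.mem_univ, and_true, not_or,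
      not_not] at hSV
    obtain ⟨hSG, hSA⟩ := hSV
    obtain ⟨t, ht, htR⟩ := hGS S hSG
    obtain ⟨ho, hmin⟩ := alphatronOutputIndex_spec d u (1 / L) hT0 S V
    have hle := hmin t ht
    simp only [hHeq, validationError] at hle
    have hsel := hAS _ hSA _ ho t ht (le_of_mul_le_mul_left hle (by positivity))
    rw [alphatron, hHeq]
    refine hsel.trans ?_
    have h1 : generalizationError D c (H t S) ≤ riskConstant ℓ₀ C * s := htR
    have h2 : validationConstant ℓ₀ C' / m ≤ validationConstant ℓ₀ C' * C / (2 * ℓ₀) * s := by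
      have hK0 : 0 < validationConstant ℓ₀ C' := by rw [validationConstant]; positivity
      -- The additive selection loss is a multiple of `1/m = q²/ℓ`, so it too is `O(L√ε)`.
      have h3 : q ^ 2 ≤ C * (s / 2) := by
        calc q ^ 2 = q * q := sq q
          _ ≤ C * B * L * q := by gcongr
          _ = C * (B * L * q) := by ring
          _ ≤ _ := by gcongr
      calc validationConstant ℓ₀ C' / m = validationConstant ℓ₀ C' * (q ^ 2 / ℓ) := by
            rw [hq2]; field_simp
        _ ≤ validationConstant ℓ₀ C' * (C * (s / 2) / ℓ₀) := by gcongr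
        _ = _ := by field_simp
    have h3 : 0 < 1 / C * s := by positivity
    rw [alphatronConstant]
    linarith

end Learnability

theorem mainTheorem9 (δ₀ : ℝ) (hδ₀ : 0 < δ₀) (hδ₀' : δ₀ < 1) :
    ∃ C₀ : ℝ, 0 < C₀ ∧ ∀ C : ℝ, C₀ ≤ C →
    ∃ C₀' : ℝ, 0 < C₀' ∧ ∀ C' : ℝ, C₀' ≤ C' →
    ∃ C'' : ℝ, 0 < C'' ∧
      ∀ (n d : ℕ) (B L ζ ε : ℝ), 0 < B → 0 < L → 0 < ζ → 0 < ε →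
      ∀ u : ℝ → unitInterval, LipschitzWith L.toNNReal u → Monotone u →
      ∀ m₁ : ℝ → ℕ,
        (∀ δ : ℝ, 0 < δ → δ ≤ δ₀ →
          max (16 * ζ ^ 4 / ε ^ 2 * Real.log (1 / δ)) (4 * B ^ 2 / ε * Real.log (1 / δ))
            ≤ (m₁ δ : ℝ)) →
        WeakPConceptLearnableBy ((alphatronLearner n d u B L C C' m₁).capped δ₀)
          (alphatronClass n d B ζ ε u) (2 * C'' * L * √ε) := by
  -- Only positivity of `C` and `C'` matters; their size enters the final constant.
  refine ⟨1, one_pos, fun C hC => ⟨1, one_pos, fun C' hC' => ?_⟩⟩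
  have hC0 : 0 < C := one_pos.trans_le hC
  have hC'0 : 0 < C' := one_pos.trans_le hC'
  have hℓ₀ : 0 < Real.log (1 / δ₀) := Real.log_pos (by rwa [lt_one_div one_pos hδ₀, one_div_one])
  obtain ⟨hR0, hV0⟩ := alphatronConstant_pos_terms hℓ₀ hC0 hC'0
  refine ⟨alphatronConstant (Real.log (1 / δ₀)) C C' / 2, ?_, ?_⟩
  · unfold alphatronConstant
    positivity
  intro n d B L ζ ε hB hL hζ hε u hu hmono m₁ hm₁ δ hδ D _ c hDc hc
  have hδ' : 0 < min δ δ₀ := lt_min hδ hδ₀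
  have hm := hm₁ _ hδ' (min_le_right _ _)
  have hℓ : Real.log (1 / δ₀) ≤ Real.log (1 / min δ δ₀) :=
    Real.log_le_log (by positivity) (one_div_le_one_div_of_le hδ' (min_le_right _ _))
  obtain ⟨F, hF, hFδ, hFS⟩ := exists_measurableSet_alphatron_error_le hB hL hζ hε hu hmono hDc hc
    hℓ₀ hC0 hC'0 hδ' hℓ ((le_max_left _ _).trans hm) ((le_max_right _ _).trans hm) rfl rfl
  rw [show 2 * (alphatronConstant (Real.log (1 / δ₀)) C C' / 2) * L * √ε =
    alphatronConstant (Real.log (1 / δ₀)) C C' * (L * √ε) by ring]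
  rw [← pi_append_preimage D _ _ hF] at hFδ
  -- The failure set need not be measurable; it lies in the preimage of the measurable set `F`.
  refine (measure_mono fun S hS => ?_).trans (hFδ.trans (ENNReal.ofReal_le_ofReal (min_le_left _ _)))
  by_contra hSF
  exact hS ⟨measurable_alphatron d hu.continuous _ _ _ _, hFS _ _ hSF⟩
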